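/- Work in complex projective three-space. A \emph{dual pencil of quadrics} $\mathcal F$ is a two-dimensional linear system of symmetric $4\times 4$ matrices, regarded as quadratic equations in plane coordinates; a nonsingular quadric $\{x : x^{T}Mx=0\}$ belongs to $\mathcal F$ if its tangential matrix $M^{-1}$ does. ``Quadric'' means nonsingular quadric. A quadric $\Gamma$ \emph{touches} a line $\ell$ at a point $x\in\ell\cap\Gamma$ if $\ell$ lies in the tangent plane $T_x\Gamma$ but not on $\Gamma$; $T_x\Gamma$ is then the tangent plane corresponding to $\ell$. A \emph{configuration} for $\mathcal F$ consists of quadrics $\Gamma_0,\Gamma_1,\Gamma_2,\Gamma_3\in\mathcal F$ and four planes $\alpha,\beta,\gamma,\delta$ tangent to $\Gamma_0$, no three of them containing a common line, such that $\Gamma_1$ touches the lines $\alpha\beta$ and $\gamma\delta$, $\Gamma_2$ touches $\alpha\gamma$ and $\beta\delta$, $\Gamma_3$ touches $\alpha\delta$ and $\beta\gamma$ (where $\alpha\beta=\alpha\cap\beta$, etc.), and the six tangent planes corresponding to these six lines all belong to one pencil of planes, i.e. contain one line $\Delta$. It is \emph{general} if each of $\alpha,\beta,\gamma,\delta$ is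 tangent to no quadric of $\mathcal F$ other than $\Gamma_0$. \textbf{Theorem.} Let $\mathcal F$ be a dual pencil of quadrics. (1) If $\mathcal F$ contains no matrix of rank one, then every quadric $\Gamma_0\in\mathcal F$ occurs in some general configuration for $\mathcal F$. (2) In every configuration, the six lines $\alpha\beta,\gamma\delta,\alpha\gamma,\beta\delta,\alpha\delta,\beta\gamma$ belong to one bundle, i.e. pass through one point. (3) A general configuration is determined by any two of its six lines together with the tangent planes corresponding to them, in the following sense. (a) If two general configurations for $\mathcal F$ have the same two adjacent lines (lines in a common plane of the quadruple, such as $\alpha\beta$ and $\alpha\gamma$, at the same places) with the same corresponding tangent planes, then they have the same planes $\alpha,\beta,\gamma,\delta$ and the same quadrics $\Gamma_0,\Gamma_1,\Gamma_2,\Gamma_3$. (b) If two general configurations for $\mathcal F$ with the same $\Gamma_0$ have the same two opposite lines (such as $\alpha\beta$ and $\gamma\delta$, at the same places) with the same corresponding tangent planes, and these two tangent planes are distinct, then the configurations coincide up to interchanging the two planes through one or through both of the given lines, and relabelling $\Gamma_1,\Gamma_2,\Gamma_3$ accordingly. -/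

import Mathlib

/-- Homogeneous coordinates of complex projective three-space: points, lines and planes are the
linear subspaces of dimension one, two and three. -/
abbrev Coord : Type := Fin 4 → ℂ

/-- A nonsingular quadric surface `x ⬝ M x = 0`, given by its (symmetric, invertible) matrix. -/
structure Quadric where
  mat : Matrix (Fin 4) (Fin 4) ℂ
  symm : mat.IsSymm
  nonsing : mat.det ≠ 0

namespace Quadric

/-- Two matrices define the same quadric when they are proportional. -/
def Same (Γ Γ' : Quadric) : Prop := ∃ c : ℂ, c ≠ 0 ∧ Γ'.mat = c • Γ.mat

/-- The point with homogeneous coordinates `x` lies on the quadric. -/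
def Contains (Γ : Quadric) (x : Coord) : Prop := Matrix.toBilin' Γ.mat x x = 0

/-- The polar plane of `x`; for a point `x` of the quadric, the tangent plane at `x`. -/
noncomputable def tangentPlane (Γ : Quadric) (x : Coord) : Submodule ℂ Coord :=
  LinearMap.ker (Matrix.toBilin' Γ.mat x)

/-- The plane `π` is tangent to the quadric at some point. -/
def IsTangentPlane (Γ : Quadric) (π : Submodule ℂ Coord) : Prop :=
  ∃ x : Coord, x ≠ 0 ∧ Γ.Contains x ∧ π = Γ.tangentPlane x

/-- The quadric touches the line `l` at a point of `l`, and `τ` is its tangent plane at this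
point of tangency: `l` passes through the point `x` of the quadric, is contained in the tangent
plane `τ` at `x`, and does not lie on the quadric. -/
def Touches (Γ : Quadric) (l τ : Submodule ℂ Coord) : Prop :=
  ∃ x : Coord, x ≠ 0 ∧ x ∈ l ∧ Γ.Contains x ∧ τ = Γ.tangentPlane x ∧ l ≤ τ ∧
    ∃ y ∈ l, ¬ Γ.Contains y

end Quadric

/-- A dual pencil of quadrics: a two-dimensional linear system of symmetric matrices, regarded as
equations in plane coordinates. -/
structure DualPencil where
  forms : Submodule ℂ (Matrix (Fin 4) (Fin 4) ℂ)
  symm : ∀ B ∈ forms, B.IsSymm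
  dim : Module.finrank ℂ forms = 2

/-- The quadric with point equation `M` has tangential equation `M⁻¹`; it belongs to the dual
pencil when its tangential equation does. -/
def DualPencil.Has (F : DualPencil) (Γ : Quadric) : Prop := Γ.mat⁻¹ ∈ F.forms

/-- Four planes `α, β, γ, δ` (indexed by `0, 1, 2, 3`) and four quadrics `Γ₀, Γ₁, Γ₂, Γ₃`. -/
structure Config where
  plane : Fin 4 → Submodule ℂ Coord
  quadric : Fin 4 → Quadric

/-- The index of the quadric that has to touch the line of intersection of planes `i` and `j`:
`Γ₁` for `αβ, γδ`, `Γ₂` for `αγ, βδ`, `Γ₃` for `αδ, βγ` (the diagonal entries are `0`). -/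
def pairIndex (i j : Fin 4) : Fin 4 :=
  (!![0, 1, 2, 3; 1, 0, 3, 2; 2, 3, 0, 1; 3, 2, 1, 0] : Matrix (Fin 4) (Fin 4) (Fin 4)) i j

namespace Config

/-- The line of intersection of the planes `i` and `j`. -/
def line (c : Config) (i j : Fin 4) : Submodule ℂ Coord := c.plane i ⊓ c.plane j

/-- `τ` is the tangent plane, at the point of tangency with the line `i j`, of the quadric of the
configuration assigned to this line. -/
def IsContactPlane (c : Config) (i j : Fin 4) (τ : Submodule ℂ Coord) : Prop :=
  (c.quadric (pairIndex i j)).Touches (c.line i j) τ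

/-- The configurations of the theorem: the four quadrics belong to `F`; the four planes are tangent
to `Γ₀`, no three of them in one pencil; each quadric `Γ₁, Γ₂, Γ₃` touches its two lines of
intersection; the six tangent planes at the points of tangency belong to one pencil, with axis
`Δ`. -/
structure IsLebesgue (c : Config) (F : DualPencil) : Prop where
  mem : ∀ k, F.Has (c.quadric k)
  tangent : ∀ i, (c.quadric 0).IsTangentPlane (c.plane i)
  no_three : ∀ i j k, i ≠ j → i ≠ k → j ≠ k → ¬ c.line i j ≤ c.plane k
  contact : ∃ Δ : Submodule ℂ Coord, Module.finrank ℂ Δ = 2 ∧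
    ∀ i j, i ≠ j → ∃ τ, c.IsContactPlane i j τ ∧ Δ ≤ τ

/-- `Γ₀` is the only quadric of `F` that is tangent to any of the four planes. -/
def IsGeneral (c : Config) (F : DualPencil) : Prop :=
  ∀ i, ∀ Γ : Quadric, F.Has Γ → Γ.IsTangentPlane (c.plane i) → (c.quadric 0).Same Γ

end Config

/-!
Planes become points `a i` of the space of plane coordinates, quadrics become their tangential
forms, and the lines `αβ`, … become the edges of the tetrahedron with vertices `a i`. A pencil of
planes is a line of this dual space, so the six contact planes lie on a line that meets all six
edges. If the `a i` were linearly independent, this line would not be contained in some face, and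
its only point on that face would have to lie on the three edges of the face. Hence the `a i` are
dependent and the four planes have a common point.

For a general configuration the common pencil lies in the kernel of a functional vanishing at no
`a i`. Scale the `a i` so that it takes the value `1`; then the contact planes are the differences
`a i - a j`. With `A` the form of `Γ₀` and `B` a second form of the pencil, the configuration
amounts to `A (a i) (a i) = 0`, `B (a i) (a i) = τ` and `(B + s A) (a i) (a j) = τ`, where `s` is
the same on opposite edges. The linear relation among the `a i`, with coefficients `c i`, gives two
linear equations for the products `c i * c j * A (a i) (a j)`, which recover the fourth plane from
the other three. Since `A` has only two isotropic points on an edge, an edge together with its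
contact plane determines its two ends up to order.

For the existence, cut `A` by a general plane and parametrize the conic as `w + x u + x⁻¹ v`.
The equation `B a a = τ` becomes a quartic in `x`. The product of its roots is `B v v / B u u` for
every `τ`, and the coefficient `s` of an edge depends only on the product of the parameters of its
ends in such a way that opposite edges get the same `s`.
-/

section

open Matrix Module Submodule

section Duality

variable {K n : Type*} [Field K] [Fintype n] [DecidableEq n]

/-- The vectors orthogonal to `S` for the dot product. Points and planes share the coordinate
space `n → K`, so `ann S` is the subspace common to the planes with coordinates in `S`, and dually
the system of planes through the points of `S`. -/
noncomputable def ann (S : Submodule K (n → K)) : Submodule K (n → K) :=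
  LinearMap.BilinForm.orthogonal (toBilin' 1) S

/-- The hyperplane `a ⬝ x = 0` with plane coordinates `a`. -/
noncomputable def planeOf (a : n → K) : Submodule K (n → K) := ann (span K {a})

variable {S : Submodule K (n → K)} {a b x : n → K}

theorem mem_ann : x ∈ ann S ↔ ∀ y ∈ S, y ⬝ᵥ x = 0 := by
  simp [ann, LinearMap.BilinForm.mem_orthogonal_iff, toBilin'_apply']

theorem nondegenerate_toBilin'_one : (toBilin' (1 : Matrix n n K)).Nondegenerate :=
  LinearMap.BilinForm.nondegenerate_toBilin'_iff_det_ne_zero.2 (by simp)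

theorem finrank_ann (S : Submodule K (n → K)) :
    finrank K (ann S) = Fintype.card n - finrank K S := by
  rw [ann, LinearMap.BilinForm.finrank_orthogonal nondegenerate_toBilin'_one,
    finrank_fintype_fun_eq_card]

theorem ann_ann (S : Submodule K (n → K)) : ann (ann S) = S :=
  LinearMap.BilinForm.orthogonal_orthogonal nondegenerate_toBilin'_one
    (isSymm_toBilin'_iff_isSymm.2 isSymm_one).isRefl S

theorem ann_injective : Function.Injective (ann : Submodule K (n → K) → Submodule K (n → K)) :=
  Function.LeftInverse.injective ann_ann

theorem mem_planeOf : x ∈ planeOf a ↔ a ⬝ᵥ x = 0 := by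
  rw [planeOf, mem_ann]
  refine ⟨fun h ↦ h a (mem_span_singleton_self a), fun h y hy ↦ ?_⟩
  obtain ⟨c, rfl⟩ := mem_span_singleton.1 hy
  simp [h]

theorem ann_le_planeOf : ann S ≤ planeOf a ↔ a ∈ S := by
  constructor
  · intro h
    rw [← ann_ann S, mem_ann]
    intro y hy
    rw [dotProduct_comm]
    exact mem_planeOf.1 (h hy)
  · exact fun h x hx ↦ mem_planeOf.2 (mem_ann.1 hx a h)

theorem planeOf_smul {c : K} (hc : c ≠ 0) (a : n → K) : planeOf (c • a) = planeOf a := by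
  ext x
  simp [mem_planeOf, hc]

theorem planeOf_inf_planeOf (a b : n → K) : planeOf a ⊓ planeOf b = ann (span K {a, b}) := by
  ext x
  simp only [mem_inf, mem_planeOf, mem_ann, mem_span_pair]
  constructor
  · rintro ⟨ha, hb⟩ _ ⟨p, q, rfl⟩
    simp [ha, hb]
  · exact fun h ↦ ⟨h a ⟨1, 0, by simp⟩, h b ⟨0, 1, by simp⟩⟩

theorem exists_smul_eq_of_planeOf_eq (hb : b ≠ 0) (h : planeOf a = planeOf b) :
    ∃ c : K, c ≠ 0 ∧ b = c • a := by
  obtain ⟨c, rfl⟩ := mem_span_singleton.1 (ann_le_planeOf.1 (h.le : ann (span K {a}) ≤ planeOf b))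
  exact ⟨c, left_ne_zero_of_smul hb, rfl⟩

variable {A : Matrix n n K}

theorem map_mulVecLin_eq_ann_of_isotropic [NeZero (2 : K)] (hA : A.IsSymm) (hd : A.det ≠ 0)
    (hS : 2 * finrank K S = Fintype.card n) (h : ∀ a ∈ S, toBilin' A a a = 0) :
    S.map A.mulVecLin = ann S := by
  apply eq_of_le_of_finrank_eq
  · rintro _ ⟨x, hx, rfl⟩
    rw [mem_ann]
    intro y hy
    change y ⬝ᵥ A *ᵥ x = 0
    rw [← toBilin'_apply', (isSymm_toBilin'_iff_isSymm.2 hA).polarization, h _ (add_mem hy hx),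
      h y hy, h x hx]
    simp
  · have hinj : Function.Injective A.mulVecLin :=
      mulVec_injective_of_isUnit ((isUnit_iff_isUnit_det A).2 hd.isUnit)
    rw [finrank_ann, ← (S.equivMapOfInjective _ hinj).finrank_eq]
    lia

theorem toBilin'_inv_mulVec (hA : A.IsSymm) (hd : A.det ≠ 0) (x y : n → K) :
    toBilin' A⁻¹ (A *ᵥ x) (A *ᵥ y) = toBilin' A x y := by
  rw [← (isSymm_toBilin'_iff_isSymm.2 hA).eq, toBilin'_apply', toBilin'_apply', mulVec_mulVec,
    nonsing_inv_mul _ hd.isUnit, one_mulVec, dotProduct_comm]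

theorem toBilin'_inv_self_eq_zero_of_mem_ann [NeZero (2 : K)] (hA : A.IsSymm) (hd : A.det ≠ 0)
    (hS : 2 * finrank K S = Fintype.card n) (h : ∀ a ∈ S, toBilin' A a a = 0)
    (hx : x ∈ ann S) : toBilin' A⁻¹ x x = 0 := by
  rw [← map_mulVecLin_eq_ann_of_isotropic hA hd hS h] at hx
  obtain ⟨a, ha, rfl⟩ := hx
  rw [mulVecLin_apply, toBilin'_inv_mulVec hA hd, h a ha]

end Duality

theorem finrank_range_toBilin' {K n : Type*} [Field K] [Fintype n] [DecidableEq n]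
    (M : Matrix n n K) : finrank K (LinearMap.range (toBilin' M)) = M.rank := by
  have hcomp : toBilin' M = (dotProductEquiv K n).toLinearMap ∘ₗ Mᵀ.mulVecLin := by
    ext x y
    simp [toBilin'_apply']
  rw [hcomp, LinearMap.range_comp, LinearEquiv.finrank_map_eq, ← rank_transpose, rank]

namespace Quadric

/-- The tangential form of a quadric: the symmetric bilinear form `Γ.mat⁻¹` on plane
coordinates. -/
noncomputable def dual (Γ : Quadric) : LinearMap.BilinForm ℂ Coord := toBilin' Γ.mat⁻¹

/-- The quadric with tangential matrix `A`. -/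
noncomputable def ofDual (A : Matrix (Fin 4) (Fin 4) ℂ) (hA : A.IsSymm) (hd : A.det ≠ 0) :
    Quadric where
  mat := A⁻¹
  symm := hA.inv
  nonsing := by simpa [det_nonsing_inv] using hd

theorem ofDual_mat_inv (A : Matrix (Fin 4) (Fin 4) ℂ) (hA : A.IsSymm) (hd : A.det ≠ 0) :
    (ofDual A hA hd).mat⁻¹ = A :=
  nonsing_inv_nonsing_inv _ hd.isUnit

variable (Γ : Quadric)

theorem det_mat_inv_ne_zero : Γ.mat⁻¹.det ≠ 0 := by
  simpa [det_nonsing_inv] using Γ.nonsing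

theorem mat_inv_inv : Γ.mat⁻¹⁻¹ = Γ.mat := nonsing_inv_nonsing_inv _ Γ.nonsing.isUnit

theorem isSymm_dual : Γ.dual.IsSymm := isSymm_toBilin'_iff_isSymm.2 Γ.symm.inv

theorem dual_apply (a b : Coord) : Γ.dual a b = a ⬝ᵥ Γ.mat⁻¹ *ᵥ b := toBilin'_apply' _ _ _

theorem mat_mulVec_inv_mulVec (a : Coord) : Γ.mat *ᵥ (Γ.mat⁻¹ *ᵥ a) = a := by
  rw [mulVec_mulVec, mul_nonsing_inv _ Γ.nonsing.isUnit, one_mulVec]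

theorem inv_mulVec_ne_zero {a : Coord} (ha : a ≠ 0) : Γ.mat⁻¹ *ᵥ a ≠ 0 := fun h ↦
  ha (by rw [← Γ.mat_mulVec_inv_mulVec a, h, mulVec_zero])

theorem exists_inv_mulVec_eq {x : Coord} (hx : x ≠ 0) : ∃ a ≠ 0, Γ.mat⁻¹ *ᵥ a = x := by
  have h : Γ.mat⁻¹ *ᵥ (Γ.mat *ᵥ x) = x := by
    rw [mulVec_mulVec, nonsing_inv_mul _ Γ.nonsing.isUnit, one_mulVec]
  exact ⟨Γ.mat *ᵥ x, fun h0 ↦ hx (by rw [← h, h0, mulVec_zero]), h⟩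

theorem contains_inv_mulVec {a : Coord} : Γ.Contains (Γ.mat⁻¹ *ᵥ a) ↔ Γ.dual a a = 0 := by
  rw [Contains, dual, ← toBilin'_inv_mulVec Γ.symm.inv Γ.det_mat_inv_ne_zero, mat_inv_inv]

theorem tangentPlane_inv_mulVec (a : Coord) : Γ.tangentPlane (Γ.mat⁻¹ *ᵥ a) = planeOf a := by
  ext y
  rw [tangentPlane, LinearMap.mem_ker, mem_planeOf, (isSymm_toBilin'_iff_isSymm.2 Γ.symm).eq,
    toBilin'_apply', mat_mulVec_inv_mulVec, dotProduct_comm]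

theorem isTangentPlane_iff {π : Submodule ℂ Coord} :
    Γ.IsTangentPlane π ↔ ∃ a : Coord, a ≠ 0 ∧ Γ.dual a a = 0 ∧ π = planeOf a := by
  constructor
  · rintro ⟨x, hx, hΓ, rfl⟩
    obtain ⟨a, ha, rfl⟩ := Γ.exists_inv_mulVec_eq hx
    exact ⟨a, ha, Γ.contains_inv_mulVec.1 hΓ, Γ.tangentPlane_inv_mulVec a⟩
  · rintro ⟨a, ha, hΓ, rfl⟩
    exact ⟨Γ.mat⁻¹ *ᵥ a, Γ.inv_mulVec_ne_zero ha, Γ.contains_inv_mulVec.2 hΓ,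
      (Γ.tangentPlane_inv_mulVec a).symm⟩

theorem isTangentPlane_planeOf {a : Coord} (ha : a ≠ 0) :
    Γ.IsTangentPlane (planeOf a) ↔ Γ.dual a a = 0 := by
  refine Γ.isTangentPlane_iff.trans ⟨?_, fun h ↦ ⟨a, ha, h, rfl⟩⟩
  rintro ⟨b, hb, hΓ, h⟩
  obtain ⟨c, hc, rfl⟩ := exists_smul_eq_of_planeOf_eq hb h
  simpa [hc] using hΓ

theorem forall_mem_ann_contains_iff {S : Submodule ℂ Coord} (hS : finrank ℂ S = 2) :
    (∀ x ∈ ann S, Γ.Contains x) ↔ ∀ a ∈ S, Γ.dual a a = 0 := by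
  constructor
  · intro h a ha
    exact toBilin'_inv_self_eq_zero_of_mem_ann Γ.symm Γ.nonsing
      (by rw [finrank_ann, hS]; rfl) h (by rwa [ann_ann])
  · intro h x hx
    have := toBilin'_inv_self_eq_zero_of_mem_ann Γ.symm.inv Γ.det_mat_inv_ne_zero
      (by rw [hS]; rfl) h hx
    rwa [mat_inv_inv] at this

theorem touches_ann_iff {S : Submodule ℂ Coord} (hS : finrank ℂ S = 2) {τ : Submodule ℂ Coord} :
    Γ.Touches (ann S) τ ↔ ∃ t ∈ S, t ≠ 0 ∧ (∀ a ∈ S, Γ.dual a t = 0) ∧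
      (∃ a ∈ S, Γ.dual a a ≠ 0) ∧ τ = planeOf t := by
  have hnot : (∃ x ∈ ann S, ¬ Γ.Contains x) ↔ ∃ a ∈ S, Γ.dual a a ≠ 0 := by
    simpa using (Γ.forall_mem_ann_contains_iff hS).not
  constructor
  · rintro ⟨x, hx, hxS, hΓ, rfl, hle, hy⟩
    obtain ⟨t, ht, rfl⟩ := Γ.exists_inv_mulVec_eq hx
    rw [tangentPlane_inv_mulVec, ann_le_planeOf] at hle
    refine ⟨t, hle, ht, fun a ha ↦ ?_, hnot.1 hy, Γ.tangentPlane_inv_mulVec t⟩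
    rw [dual_apply]
    exact mem_ann.1 hxS a ha
  · rintro ⟨t, htS, ht, hrad, hy, rfl⟩
    refine ⟨Γ.mat⁻¹ *ᵥ t, Γ.inv_mulVec_ne_zero ht, mem_ann.2 fun a ha ↦ ?_,
      Γ.contains_inv_mulVec.2 (hrad t htS), (Γ.tangentPlane_inv_mulVec t).symm,
      ann_le_planeOf.2 htS, hnot.2 hy⟩
    rw [← dual_apply, hrad a ha]

theorem same_iff {Γ Γ' : Quadric} : Γ.Same Γ' ↔ ∃ c : ℂ, c ≠ 0 ∧ Γ'.mat⁻¹ = c • Γ.mat⁻¹ := by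
  have smul_inv : ∀ {A B : Matrix (Fin 4) (Fin 4) ℂ} {c : ℂ}, A.det ≠ 0 → c ≠ 0 → B = c • A →
      B⁻¹ = c⁻¹ • A⁻¹ := by
    rintro A _ c hA hc rfl
    exact inv_eq_left_inv (by
      rw [smul_mul_smul_comm, inv_mul_cancel₀ hc, one_smul, nonsing_inv_mul _ hA.isUnit])
  constructor
  · rintro ⟨c, hc, h⟩
    exact ⟨c⁻¹, inv_ne_zero hc, smul_inv Γ.nonsing hc h⟩
  · rintro ⟨c, hc, h⟩
    have := smul_inv Γ.det_mat_inv_ne_zero hc h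
    rw [mat_inv_inv, mat_inv_inv] at this
    exact ⟨c⁻¹, inv_ne_zero hc, this⟩

end Quadric

theorem exists_edge_avoiding (l m : Fin 4) :
    ∃ i j, i ≠ j ∧ l ≠ i ∧ l ≠ j ∧ m ≠ i ∧ m ≠ j := by
  decide +revert

theorem not_meets_all_edges {K V : Type*} [Field K] [AddCommGroup V] [Module K V]
    (b : Basis (Fin 4) K V) {D : Submodule K V} (hD : finrank K D = 2) :
    ¬ ∀ i j, i ≠ j → ∃ d ∈ D, d ≠ 0 ∧ d ∈ span K {b i, b j} := by
  intro hedge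
  choose! d hdD hd0 hdspan using hedge
  have coord_edge : ∀ i j l, i ≠ j → l ≠ i → l ≠ j → b.coord l (d i j) = 0 := by
    intro i j l hij hi hj
    obtain ⟨p, q, h⟩ := mem_span_pair.1 (hdspan i j hij)
    simp [← h, hi.symm, hj.symm]
  obtain ⟨l, hl⟩ : ∃ l, (b.coord l).domRestrict D ≠ 0 := by
    by_contra! h
    refine hd0 0 1 (by decide) (b.ext_elem fun m ↦ ?_)
    simpa using LinearMap.congr_fun (h m) ⟨d 0 1, hdD 0 1 (by decide)⟩
  have hker : finrank K (LinearMap.ker ((b.coord l).domRestrict D)) = 1 := by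
    have := FiniteDimensional.of_finrank_pos (K := K) (V := D) (by lia)
    have hrange := LinearMap.range_eq_top.2 (LinearMap.surjective hl)
    have hadd := ((b.coord l).domRestrict D).finrank_range_add_finrank_ker
    rw [hrange, finrank_top, finrank_self, hD] at hadd
    lia
  have smul_edge : ∀ i j i' j', i ≠ j → i' ≠ j' → l ≠ i → l ≠ j → l ≠ i' → l ≠ j' →
      ∃ c : K, c • d i j = d i' j' := by
    intro i j i' j' hij hij' hi hj hi' hj'
    obtain ⟨c, hc⟩ := (finrank_eq_one_iff_of_nonzero' (K := K)
      (⟨⟨d i j, hdD i j hij⟩, coord_edge i j l hij hi hj⟩ :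
        LinearMap.ker ((b.coord l).domRestrict D)) fun h ↦ hd0 i j hij (congrArg (·.1.1) h)).1 hker
      ⟨⟨d i' j', hdD i' j' hij'⟩, coord_edge i' j' l hij' hi' hj'⟩
    exact ⟨c, congrArg (·.1.1) hc⟩
  obtain ⟨i, j, hij, hi, hj, -⟩ := exists_edge_avoiding l l
  refine hd0 i j hij (b.ext_elem fun m ↦ ?_)
  obtain ⟨i', j', hij', hi', hj', hmi, hmj⟩ := exists_edge_avoiding l m
  obtain ⟨c, hc⟩ := smul_edge i' j' i j hij' hij hi' hj' hi hj
  have := coord_edge i' j' m hij' hmi hmj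
  simp_all [← hc]

section FourIndices

theorem pairIndex_comm (i j : Fin 4) : pairIndex i j = pairIndex j i := by decide +revert

theorem pairIndex_self (i : Fin 4) : pairIndex i i = 0 := by decide +revert

theorem pairIndex_zero_left (k : Fin 4) : pairIndex 0 k = k := by decide +revert

theorem pairIndex_ne_zero {i j : Fin 4} (h : i ≠ j) : pairIndex i j ≠ 0 := by decide +revert

theorem pairIndex_opposite {i j k l : Fin 4} (h : [i, j, k, l].Nodup) :
    pairIndex i j = pairIndex k l := by
  decide +revert

theorem exists_nodup_of_ne {i j : Fin 4} (h : i ≠ j) : ∃ k l, [i, j, k, l].Nodup := by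
  decide +revert

theorem exists_fourth {i j k : Fin 4} (h : [i, j, k].Nodup) : ∃ l, [i, j, k, l].Nodup := by
  decide +revert

theorem eq_or_eq_of_nodup {i j k l : Fin 4} (h : [i, j, k, l].Nodup) (m : Fin 4) :
    m = i ∨ m = j ∨ m = k ∨ m = l := by
  decide +revert

@[to_additive]
theorem prod_eq_of_nodup {M : Type*} [CommMonoid M] (f : Fin 4 → M) {i j k l : Fin 4}
    (h : [i, j, k, l].Nodup) : ∏ m, f m = f i * f j * f k * f l := by
  have huniv : (Finset.univ : Finset (Fin 4)) = {i, j, k, l} := by decide +revert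
  obtain ⟨⟨hij, hik, hil⟩, ⟨hjk, hjl⟩, hkl⟩ :
      (i ≠ j ∧ i ≠ k ∧ i ≠ l) ∧ (j ≠ k ∧ j ≠ l) ∧ k ≠ l := by simpa using h
  rw [huniv, Finset.prod_insert (by simp [*]), Finset.prod_insert (by simp [*]),
    Finset.prod_pair hkl, mul_assoc, mul_assoc]

theorem mul_pairIndex_eq_or {M : Type*} [CommMonoid M] (x : Fin 4 → M) {i j : Fin 4}
    (hij : i ≠ j) :
    x i * x j = x 0 * x (pairIndex i j) ∨
      x i * x j * (x 0 * x (pairIndex i j)) = ∏ n, x n := by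
  have hcases : (i = 0 ∧ j = pairIndex i j) ∨ (j = 0 ∧ i = pairIndex i j) ∨
      [i, j, 0, pairIndex i j].Nodup := by decide +revert
  obtain ⟨hi, hj⟩ | ⟨hj, hi⟩ | h := hcases
  · rw [← hj, hi]
    exact .inl rfl
  · rw [← hi, hj]
    exact .inl (mul_comm _ _)
  · exact .inr (by rw [prod_eq_of_nodup x h, mul_assoc, mul_assoc, mul_assoc])

end FourIndices

theorem mul_eq_mul_of_orthogonal_pair {K : Type*} [Field K] {x y z x' y' z' p q r : K}
    (hx : x + y + z = 0) (hx' : x' + y' + z' = 0) (hp : p * x + q * y + r * z = 0)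
    (hp' : p * x' + q * y' + r * z' = 0)
    (hpqr : ¬ (p = r ∧ q = r)) : x * y' = x' * y := by
  by_contra hne
  have hne := sub_ne_zero.2 hne
  refine hpqr ⟨sub_eq_zero.1 (mul_right_cancel₀ hne ?_), sub_eq_zero.1 (mul_right_cancel₀ hne ?_)⟩
  · linear_combination y' * hp - y * hp' - r * y' * hx + r * y * hx'
  · linear_combination x * hp' - x' * hp - r * x * hx' + r * x' * hx

section BilinearForms

variable {K V : Type*} [Field K] [AddCommGroup V] [Module K V] {A C : LinearMap.BilinForm K V}
  {u v w u' v' : V}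

theorem linearIndependent_triple_iff :
    LinearIndependent K ![u, v, w] ↔
      ∀ p q r : K, p • u + q • v + r • w = 0 → p = 0 ∧ q = 0 ∧ r = 0 := by
  rw [Fintype.linearIndependent_iff]
  constructor
  · intro h p q r hpqr
    have := h ![p, q, r] (by simpa [Fin.sum_univ_three] using hpqr)
    exact ⟨this 0, this 1, this 2⟩
  · intro h c hc
    have := h (c 0) (c 1) (c 2) (by simpa [Fin.sum_univ_three] using hc)
    simpa [Fin.forall_fin_succ] using this

theorem two_mul_card_le_of_gram_const [FiniteDimensional K V] (hC : C.Nondegenerate)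
    {ι : Type*} [Fintype ι] {v : ι → V} (hv : LinearIndependent K v) {τ : K}
    (h : ∀ i j, C (v i) (v j) = τ) : 2 * Fintype.card ι ≤ finrank K V + 1 := by
  rcases isEmpty_or_nonempty ι with _ | _
  · simp
  have hperp : vectorSpan K (Set.range v) ≤ C.orthogonal (span K (Set.range v)) := by
    rw [vectorSpan_def, span_le]
    rintro _ ⟨_, ⟨i, rfl⟩, _, ⟨j, rfl⟩, rfl⟩
    have hker : span K (Set.range v) ≤ LinearMap.ker (C.flip (v i - v j)) := by
      rw [span_le]
      rintro _ ⟨m, rfl⟩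
      simp [h]
    exact hker
  have hle := finrank_mono hperp
  have hvec := hv.affineIndependent.finrank_vectorSpan_add_one
  have hspan := finrank_span_eq_card hv
  have := LinearMap.BilinForm.finrank_orthogonal hC (span K (Set.range v))
  have := (span K (Set.range v)).finrank_le
  lia

theorem eq_smul_or_eq_smul_of_isotropic [NeZero (2 : K)] (hA : A.IsSymm) (hu : A u u = 0)
    (hv : A v v = 0) (huv : A u v ≠ 0) (hw : w ∈ span K {u, v}) (hww : A w w = 0) :
    ∃ e : K, w = e • u ∨ w = e • v := by
  obtain ⟨p, q, rfl⟩ := mem_span_pair.1 hw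
  have hpq : 2 * (p * q * A u v) = 0 := by
    simp only [map_add, LinearMap.add_apply, map_smul, LinearMap.smul_apply, smul_eq_mul, hu, hv,
      hA.eq v u] at hww
    linear_combination hww
  have : p = 0 ∨ q = 0 := by simpa [huv, two_ne_zero] using hpq
  rcases this with rfl | rfl
  · exact ⟨q, .inr (by simp)⟩
  · exact ⟨p, .inl (by simp)⟩

theorem eq_smul_pair_of_isotropic [NeZero (2 : K)] (hA : A.IsSymm) (hu : A u u = 0)
    (hv : A v v = 0) (huv : A u v ≠ 0) (hu' : u' ∈ span K {u, v}) (hv' : v' ∈ span K {u, v})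
    (huu' : A u' u' = 0) (hvv' : A v' v' = 0) (huv' : A u' v' ≠ 0) {r : K}
    (hr : u' - v' = r • (u - v)) :
    ∃ e : K, (u' = e • u ∧ v' = e • v) ∨ (u' = e • v ∧ v' = e • u) := by
  have hru := congrArg (A u) hr
  have hrv := congrArg (A v) hr
  have hvu : A v u = A u v := hA.eq v u
  obtain ⟨e, rfl | rfl⟩ := eq_smul_or_eq_smul_of_isotropic hA hu hv huv hu' huu' <;>
    obtain ⟨e', rfl | rfl⟩ := eq_smul_or_eq_smul_of_isotropic hA hu hv huv hv' hvv' <;>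
    simp only [map_sub, map_smul, LinearMap.smul_apply, smul_eq_mul, hu, hv, hvu, mul_zero,
      sub_zero, zero_sub, ne_eq, not_true] at hru hrv huv'
  · have he : e = e' := mul_right_cancel₀ huv (by linear_combination hrv + hru)
    exact ⟨e, .inl ⟨rfl, by rw [he]⟩⟩
  · have he : e = e' := mul_right_cancel₀ huv (by linear_combination hrv + hru)
    exact ⟨e, .inr ⟨rfl, by rw [he]⟩⟩

theorem linearIndependent_triple_of_notMem_span (hu : u ∉ span K {v, w}) (hv : v ∉ span K {u, w})
    (hw : w ∉ span K {u, v}) : LinearIndependent K ![u, v, w] := by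
  refine linearIndependent_triple_iff.2 fun p q r h ↦ ⟨?_, ?_, ?_⟩ <;> by_contra h0
  · exact hu (mem_span_pair.2 ⟨-(q / p), -(r / p), by
      linear_combination (norm := (match_scalars <;> field_simp <;> ring)) (-p⁻¹) • h⟩)
  · exact hv (mem_span_pair.2 ⟨-(p / q), -(r / q), by
      linear_combination (norm := (match_scalars <;> field_simp <;> ring)) (-q⁻¹) • h⟩)
  · exact hw (mem_span_pair.2 ⟨-(p / r), -(q / r), by
      linear_combination (norm := (match_scalars <;> field_simp <;> ring)) (-r⁻¹) • h⟩)

theorem exists_smul_eq_of_mem_span_pairs (h : LinearIndependent K ![u, v, w])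
    (hv : u' ∈ span K {u, v}) (hw : u' ∈ span K {u, w}) : ∃ e : K, u' = e • u := by
  obtain ⟨p, q, rfl⟩ := mem_span_pair.1 hv
  obtain ⟨p', r, hpr⟩ := mem_span_pair.1 hw
  obtain ⟨-, rfl, -⟩ := linearIndependent_triple_iff.1 h (p - p') q (-r) (by
    linear_combination (norm := module) -hpr)
  exact ⟨p, by rw [zero_smul, add_zero]⟩

theorem finrank_span_pair_of_triple (h : LinearIndependent K ![u, v, w]) :
    finrank K (span K {u, v}) = 2 := by
  have huv : LinearIndependent K ![u, v] := LinearIndependent.pair_iff.2 fun p q hpq ↦ by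
    obtain ⟨hp, hq, -⟩ := linearIndependent_triple_iff.1 h p q 0 (by rw [hpq, zero_smul, zero_add])
    exact ⟨hp, hq⟩
  rw [← range_cons_cons_empty u v ![], finrank_span_eq_card huv, Fintype.card_fin]

end BilinearForms

section Frame

variable {K V : Type*} [Field K] [AddCommGroup V] [Module K V]

/-- The linear algebra of a configuration, in plane coordinates. The forms `A` and `B + s k • A`
for `k ≠ 0` are the tangential forms of the four quadrics, and `a i` are coordinates of the four
planes, normalised by `height` and `contact` so that `a i - a j` are the coordinates of the six
contact planes; `height` says that these lie in a pencil, as all of them satisfy `f = 0`. -/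
structure IsContactFrame (A B : LinearMap.BilinForm K V) (a : Fin 4 → V) (s : Fin 4 → K) (τ : K) :
    Prop where
  isotropic : ∀ i, A (a i) (a i) = 0
  norm : ∀ i, B (a i) (a i) = τ
  norm_ne_zero : τ ≠ 0
  contact : ∀ i j, i ≠ j → B (a i) (a j) + s (pairIndex i j) * A (a i) (a j) = τ
  nondegenerate : ∀ k, k ≠ 0 → (B + s k • A).Nondegenerate
  independent : ∀ i j k, [i, j, k].Nodup → LinearIndependent K ![a i, a j, a k]
  height : ∃ f : Dual K V, ∀ i, f (a i) = 1
  dependent : ¬ LinearIndependent K a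

namespace IsContactFrame

variable {A B : LinearMap.BilinForm K V} {a a' : Fin 4 → V} {s s' : Fin 4 → K} {τ τ' : K}
  {i j k l : Fin 4}

theorem smul (h : IsContactFrame A B a s τ) {e : K} (he : e ≠ 0) :
    IsContactFrame A B (e • a) s (e ^ 2 * τ) where
  isotropic i := by simp [h.isotropic i]
  norm i := by
    simp only [Pi.smul_apply, map_smul, LinearMap.smul_apply, smul_eq_mul, h.norm i]
    ring
  norm_ne_zero := mul_ne_zero (pow_ne_zero 2 he) h.norm_ne_zero
  contact i j hij := by
    simp only [Pi.smul_apply, map_smul, LinearMap.smul_apply, smul_eq_mul, ← h.contact i j hij]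
    ring
  nondegenerate := h.nondegenerate
  independent i j k hijk := by
    have := (h.independent i j k hijk).units_smul fun _ ↦ Units.mk0 e he
    convert this using 1
    ext m
    fin_cases m <;> rfl
  height := by
    obtain ⟨f, hf⟩ := h.height
    exact ⟨e⁻¹ • f, fun i ↦ by simp [hf, he]⟩
  dependent := fun hind ↦ h.dependent (by
    convert hind.units_smul fun _ ↦ (Units.mk0 e he)⁻¹ using 1
    ext i
    simp [Units.smul_def, he])

theorem ne_zero (h : IsContactFrame A B a s τ) (i : Fin 4) : a i ≠ 0 := fun h0 ↦
  h.norm_ne_zero (by rw [← h.norm i, h0, map_zero])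

theorem injective (h : IsContactFrame A B a s τ) : Function.Injective a := by
  intro i j hij
  by_contra hne
  obtain ⟨k, l, hijkl⟩ := exists_nodup_of_ne hne
  exact (h.independent i j k (by grind)).injective.ne (zero_ne_one : (0 : Fin 3) ≠ 1) hij

theorem exists_relation (h : IsContactFrame A B a s τ) :
    ∃ c : Fin 4 → K, (∀ i, c i ≠ 0) ∧ ∑ i, c i • a i = 0 ∧ ∑ i, c i = 0 := by
  obtain ⟨c, hc, m, hm⟩ := Fintype.not_linearIndependent_iff.1 h.dependent
  obtain ⟨f, hf⟩ := h.height
  refine ⟨c, fun l hl ↦ hm ?_, hc, by simpa [hf] using congrArg f hc⟩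
  by_contra hm
  have hlm : l ≠ m := fun h ↦ hm (h ▸ hl)
  obtain ⟨j, k, hlmjk⟩ := exists_nodup_of_ne hlm
  rw [sum_eq_of_nodup _ hlmjk, hl, zero_smul, zero_add] at hc
  exact hm (linearIndependent_triple_iff.1 (h.independent m j k hlmjk.of_cons) _ _ _ hc).1

theorem finrank_vectorSpan (h : IsContactFrame A B a s τ) :
    finrank K (vectorSpan K (Set.range a)) = 2 := by
  apply le_antisymm
  · rw [finrank_vectorSpan_le_iff_not_affineIndependent K a (Fintype.card_fin 4),
      affineIndependent_iff]
    obtain ⟨c, hc, hrel, hsum⟩ := h.exists_relation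
    exact fun hind ↦ hc 0 (hind Finset.univ c hsum hrel 0 (Finset.mem_univ 0))
  · have hind := (h.independent 0 1 2 (by decide)).affineIndependent
    rw [← hind.finrank_vectorSpan (Fintype.card_fin 3)]
    have : FiniteDimensional K (vectorSpan K (Set.range a)) :=
      finiteDimensional_vectorSpan_range K a
    refine finrank_mono (vectorSpan_mono K ?_)
    rintro _ ⟨m, rfl⟩
    fin_cases m <;> exact Set.mem_range_self _

theorem not_gram_const [FiniteDimensional K V] (hV : finrank K V ≤ 4)
    (h : IsContactFrame A B a s τ) (hijk : [i, j, k].Nodup) {C : LinearMap.BilinForm K V}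
    (hC : C.IsSymm) (hnd : C.Nondegenerate) (hi : C (a i) (a i) = τ) (hj : C (a j) (a j) = τ)
    (hk : C (a k) (a k) = τ) (hij : C (a i) (a j) = τ) (hik : C (a i) (a k) = τ)
    (hjk : C (a j) (a k) = τ) : False := by
  have hcard := two_mul_card_le_of_gram_const hnd (h.independent i j k hijk) (τ := τ) (by
    simp [Fin.forall_fin_succ, *, hC.eq (a j) (a i), hC.eq (a k)])
  rw [Fintype.card_fin] at hcard
  lia

theorem polar_ne_zero [FiniteDimensional K V] (hV : finrank K V ≤ 4) (hA : A.IsSymm)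
    (hB : B.IsSymm) (h : IsContactFrame A B a s τ) (hij : i ≠ j) : A (a i) (a j) ≠ 0 := by
  intro h0
  obtain ⟨k, l, hijkl⟩ := exists_nodup_of_ne hij
  have hik : i ≠ k := by grind
  have hjl : j ≠ l := by grind
  set C := B + s (pairIndex i k) • A
  have hCapply : ∀ x y, C x y = B x y + s (pairIndex i k) * A x y := fun x y ↦ rfl
  have hC : C.IsSymm := hB.add (hA.smul _)
  have hself : ∀ m, C (a m) (a m) = τ := fun m ↦ by
    rw [hCapply, h.isotropic, h.norm, mul_zero, add_zero]
  have hCij : C (a i) (a j) = τ := by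
    rw [hCapply, h0, mul_zero, ← h.contact i j hij, h0, mul_zero]
  have hCik : C (a i) (a k) = τ := h.contact i k hik
  have hCjl : C (a j) (a l) = τ := by
    rw [hCapply, pairIndex_opposite (by grind : [i, k, j, l].Nodup), h.contact j l hjl]
  obtain ⟨c, hc, hrel, hsum⟩ := h.exists_relation
  rw [sum_eq_of_nodup _ hijkl] at hrel hsum
  have hCjk : C (a j) (a k) = τ := by
    have := congrArg (C (a j)) hrel
    simp only [map_add, map_smul, map_zero, smul_eq_mul, hself, hC.eq (a j) (a i), hCij,
      hCjl] at this
    exact mul_left_cancel₀ (hc k) (by linear_combination this - τ * hsum)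
  exact h.not_gram_const hV (by grind : [i, j, k].Nodup) hC
    (h.nondegenerate _ (pairIndex_ne_zero hik)) (hself i) (hself j) (hself k) hCij hCik hCjk

theorem eq_one_of_height (h : IsContactFrame A B a s τ) (hijkl : [i, j, k, l].Nodup)
    {f : Dual K V} {e : K} (hi : f (a i) = 1) (hj : f (a j) = 1) (hk : f (a k) = e)
    (hl : f (a l) = e) (hne : ∀ r : K, r ≠ 0 → a k - a l ≠ r • (a i - a j)) : e = 1 := by
  obtain ⟨c, hc, hrel, hsum⟩ := h.exists_relation
  rw [sum_eq_of_nodup _ hijkl] at hrel hsum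
  have hf := congrArg f hrel
  simp only [map_add, map_smul, map_zero, smul_eq_mul, hi, hj, hk, hl] at hf
  by_contra he
  have hcij : c i + c j = 0 :=
    (mul_eq_zero.1 (by linear_combination hf - e * hsum : (1 - e) * (c i + c j) = 0)).resolve_left
      (sub_ne_zero.2 (Ne.symm he))
  have hckl : c k + c l = 0 := by linear_combination hsum - hcij
  refine hne (-(c i / c k)) (neg_ne_zero.2 (div_ne_zero (hc i) (hc k))) ?_
  have hsmul : c k • (a k - a l) = c k • (-(c i / c k)) • (a i - a j) := by
    rw [smul_smul, mul_neg, mul_div_cancel₀ _ (hc k)]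
    linear_combination (norm := module) hrel - hcij • a j - hckl • a l
  exact smul_right_injective V (hc k) hsmul

theorem polar_sum_eq_zero [NeZero (2 : K)] (hA : A.IsSymm) (h : IsContactFrame A B a s τ)
    (hijkl : [i, j, k, l].Nodup) {c : Fin 4 → K} (hc : ∑ m, c m • a m = 0) :
    c i * c j * A (a i) (a j) + c i * c k * A (a i) (a k) + c j * c k * A (a j) (a k) = 0 := by
  rw [sum_eq_of_nodup _ hijkl] at hc
  have hl : c i • a i + c j • a j + c k • a k = -(c l • a l) := eq_neg_of_add_eq_zero_left hc
  have hA2 := congrArg (fun x ↦ A x x) hl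
  simp only [map_add, map_neg, map_smul, LinearMap.add_apply, LinearMap.neg_apply,
    LinearMap.smul_apply, smul_eq_mul, h.isotropic, hA.eq (a j) (a i), hA.eq (a k)] at hA2
  exact mul_left_cancel₀ two_ne_zero (by linear_combination hA2)

theorem contact_sum_eq_zero [NeZero (2 : K)] (hB : B.IsSymm) (h : IsContactFrame A B a s τ)
    (hijkl : [i, j, k, l].Nodup) {c : Fin 4 → K} (hc : ∑ m, c m • a m = 0) (hsum : ∑ m, c m = 0) :
    s (pairIndex i j) * (c i * c j * A (a i) (a j)) +
      s (pairIndex i k) * (c i * c k * A (a i) (a k)) +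
      s (pairIndex j k) * (c j * c k * A (a j) (a k)) = 0 := by
  rw [sum_eq_of_nodup _ hijkl] at hc hsum
  have hl : c i • a i + c j • a j + c k • a k = -(c l • a l) := eq_neg_of_add_eq_zero_left hc
  have hB2 := congrArg (fun x ↦ B x x) hl
  simp only [map_add, map_neg, map_smul, LinearMap.add_apply, LinearMap.neg_apply,
    LinearMap.smul_apply, smul_eq_mul, h.norm, hB.eq (a j) (a i), hB.eq (a k)] at hB2
  have hij := h.contact i j (by grind)
  have hik := h.contact i k (by grind)
  have hjk := h.contact j k (by grind)
  exact mul_left_cancel₀ two_ne_zero (by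
    linear_combination -hB2 + 2 * c i * c j * hij + 2 * c i * c k * hik + 2 * c j * c k * hjk +
      τ * (c i + c j + c k - c l) * hsum)

theorem shift_not_all_eq [FiniteDimensional K V] (hV : finrank K V ≤ 4) (hA : A.IsSymm)
    (hB : B.IsSymm) (h : IsContactFrame A B a s τ) (hijk : [i, j, k].Nodup) :
    ¬ (s (pairIndex i j) = s (pairIndex j k) ∧ s (pairIndex i k) = s (pairIndex j k)) := by
  rintro ⟨hij, hik⟩
  have hself : ∀ m, (B + s (pairIndex j k) • A) (a m) (a m) = τ := fun m ↦ by
    simp [h.isotropic, h.norm]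
  exact h.not_gram_const hV hijk (hB.add (hA.smul _))
    (h.nondegenerate _ (pairIndex_ne_zero (by grind))) (hself i) (hself j) (hself k)
    (by rw [← hij]; exact h.contact i j (by grind)) (by rw [← hik]; exact h.contact i k (by grind))
    (h.contact j k (by grind))

theorem shift_eq [FiniteDimensional K V] (hV : finrank K V ≤ 4) (hA : A.IsSymm)
    (hB : B.IsSymm) (h : IsContactFrame A B a s τ) (h' : IsContactFrame A B a' s' τ')
    {σ : Equiv.Perm (Fin 4)} (hij : i ≠ j) (hi : a' i = a (σ i)) (hj : a' j = a (σ j)) :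
    s' (pairIndex i j) = s (pairIndex (σ i) (σ j)) := by
  have hτ : τ' = τ := by rw [← h'.norm i, hi, h.norm]
  have hσ := σ.injective.ne hij
  refine mul_right_cancel₀ (h.polar_ne_zero hV hA hB hσ) ?_
  have hcontact' := h'.contact i j hij
  rw [hi, hj] at hcontact'
  linear_combination hcontact' + hτ - h.contact _ _ hσ

theorem fourth_eq [NeZero (2 : K)] [FiniteDimensional K V] (hV : finrank K V ≤ 4) (hA : A.IsSymm)
    (hB : B.IsSymm) (h : IsContactFrame A B a s τ) (h' : IsContactFrame A B a' s' τ')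
    (hijkl : [i, j, k, l].Nodup) (hi : a' i = a i) (hj : a' j = a j) (hk : a' k = a k) :
    a' l = a l := by
  obtain ⟨c, hc, hrel, hsum⟩ := h.exists_relation
  obtain ⟨c', hc', hrel', hsum'⟩ := h'.exists_relation
  have hs {m n} (hmn : m ≠ n) (hm : a' m = a m) (hn : a' n = a n) :
      s' (pairIndex m n) = s (pairIndex m n) := h.shift_eq hV hA hB h' (σ := 1) hmn hm hn
  have cross {m n p} (hmnp : [m, n, p, l].Nodup) (hm : a' m = a m) (hn : a' n = a n)
      (hp : a' p = a p) : c n * c' p = c' n * c p := by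
    have h2 := h'.contact_sum_eq_zero hB hmnp hrel' hsum'
    have h1 := h'.polar_sum_eq_zero hA hmnp hrel'
    rw [hm, hn, hp] at h1 h2
    rw [hs (by grind) hm hn, hs (by grind) hm hp, hs (by grind) hn hp] at h2
    have := mul_eq_mul_of_orthogonal_pair (h.polar_sum_eq_zero hA hmnp hrel) h1
      (h.contact_sum_eq_zero hB hmnp hrel hsum) h2 (h.shift_not_all_eq hV hA hB (by grind))
    have hpos : c m * c' m * A (a m) (a n) * A (a m) (a p) ≠ 0 := by
      simp [hc, hc', h.polar_ne_zero hV hA hB (by grind : m ≠ n),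
        h.polar_ne_zero hV hA hB (by grind : m ≠ p)]
    exact mul_left_cancel₀ hpos (by linear_combination this)
  have hci := cross (by grind : [j, i, k, l].Nodup) hj hi hk
  have hcj := cross hijkl hi hj hk
  rw [sum_eq_of_nodup _ hijkl] at hrel hrel' hsum hsum'
  rw [hi, hj, hk] at hrel'
  have hcl : c l * c' k = c' l * c k := by
    linear_combination c' k * hsum - c k * hsum' - hci - hcj
  have hsmul : (c' l * c k) • a' l = (c' l * c k) • a l := by
    linear_combination (norm := module)
      c k • hrel' - c' k • hrel + hci • a i + hcj • a j + hcl • a l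
  exact smul_right_injective V (mul_ne_zero (hc' l) (hc k)) hsmul

theorem eq_smul_of_adjacent [NeZero (2 : K)] [FiniteDimensional K V] (hV : finrank K V ≤ 4)
    (hA : A.IsSymm) (hB : B.IsSymm) (h : IsContactFrame A B a s τ)
    (h' : IsContactFrame A B a' s' τ') (hijk : [i, j, k].Nodup) {e : K} (he : e ≠ 0)
    (hi : a' i = e • a i) (hj : ∃ r : K, r ≠ 0 ∧ a' i - a' j = r • (a i - a j))
    (hk : ∃ r : K, r ≠ 0 ∧ a' i - a' k = r • (a i - a k)) (m : Fin 4) : a' m = e • a m := by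
  have hes := h.smul he
  have adjacent_eq {n : Fin 4} (hin : i ≠ n)
      (hn : ∃ r : K, r ≠ 0 ∧ a' i - a' n = r • (a i - a n)) : a' n = e • a n := by
    obtain ⟨r, hr, hrn⟩ := hn
    have hsub : a' n = (e - r) • a i + r • a n := by
      linear_combination (norm := module) hi - hrn
    have hiso := h'.isotropic n
    simp only [hsub, map_add, map_smul, LinearMap.add_apply, LinearMap.smul_apply, smul_eq_mul,
      h.isotropic, hA.eq (a n) (a i)] at hiso
    have her : 2 * (r * A (a i) (a n)) * (e - r) = 0 := by linear_combination hiso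
    have := (mul_eq_zero.1 her).resolve_left
      (mul_ne_zero two_ne_zero (mul_ne_zero hr (h.polar_ne_zero hV hA hB hin)))
    rw [hsub, ← sub_eq_zero.1 this, sub_self, zero_smul, zero_add]
  have hj' := adjacent_eq (by grind) hj
  have hk' := adjacent_eq (by grind) hk
  obtain ⟨l, hijkl⟩ := exists_fourth hijk
  have hl' := hes.fourth_eq hV hA hB h' hijkl hi hj' hk'
  obtain rfl | rfl | rfl | rfl := eq_or_eq_of_nodup hijkl m
  exacts [hi, hj', hk', hl']

theorem exists_perm_pair [NeZero (2 : K)] [FiniteDimensional K V] (hV : finrank K V ≤ 4)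
    (hA : A.IsSymm) (hB : B.IsSymm) (h : IsContactFrame A B a s τ)
    (h' : IsContactFrame A B a' s' τ') (hij : i ≠ j)
    (hspan : span K {a' i, a' j} = span K {a i, a j}) {r : K}
    (hr : a' i - a' j = r • (a i - a j)) :
    ∃ e : K, e ≠ 0 ∧ ∃ σ : Equiv.Perm (Fin 4),
      ((σ i = i ∧ σ j = j) ∨ (σ i = j ∧ σ j = i)) ∧ (∀ m, m ≠ i → m ≠ j → σ m = m) ∧
        a' i = e • a (σ i) ∧ a' j = e • a (σ j) := by
  obtain ⟨e, hcases⟩ := eq_smul_pair_of_isotropic hA (h.isotropic i) (h.isotropic j)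
    (h.polar_ne_zero hV hA hB hij) (hspan ▸ subset_span (by simp))
    (hspan ▸ subset_span (by simp)) (h'.isotropic i) (h'.isotropic j)
    (h'.polar_ne_zero hV hA hB hij) hr
  refine ⟨e, ?_, ?_⟩
  · rintro rfl
    exact h'.ne_zero i (by simpa using hcases : a' i = 0 ∧ a' j = 0).1
  · obtain hid | hswap := hcases
    · exact ⟨1, .inl ⟨rfl, rfl⟩, fun _ _ _ ↦ rfl, hid⟩
    · exact ⟨Equiv.swap i j, .inr ⟨Equiv.swap_apply_left i j, Equiv.swap_apply_right i j⟩,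
        fun _ ↦ Equiv.swap_apply_of_ne_of_ne, by simpa using hswap⟩

theorem exists_perm_of_opposite [NeZero (2 : K)] [FiniteDimensional K V] (hV : finrank K V ≤ 4)
    (hA : A.IsSymm) (hB : B.IsSymm) (h : IsContactFrame A B a s τ)
    (h' : IsContactFrame A B a' s' τ') (hijkl : [i, j, k, l].Nodup)
    (hij : span K {a' i, a' j} = span K {a i, a j}) {r : K} (hr : a' i - a' j = r • (a i - a j))
    (hkl : span K {a' k, a' l} = span K {a k, a l}) {t : K} (ht : a' k - a' l = t • (a k - a l))
    (hne : ∀ p : K, p ≠ 0 → a' k - a' l ≠ p • (a' i - a' j)) :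
    ∃ σ : Equiv.Perm (Fin 4), ((σ i = i ∧ σ j = j) ∨ (σ i = j ∧ σ j = i)) ∧
      ∃ e : K, e ≠ 0 ∧ ∀ m, a' m = e • a (σ m) := by
  obtain ⟨e, he, σ, hσ, hσfix, hi, hj⟩ := h.exists_perm_pair hV hA hB h' (by grind) hij hr
  obtain ⟨d, -, ρ, hρ, hρfix, hk, hl⟩ := h.exists_perm_pair hV hA hB h' (by grind) hkl ht
  obtain ⟨f, hf⟩ := h.height
  have hde : d * e⁻¹ = 1 := h'.eq_one_of_height hijkl (f := e⁻¹ • f) (by simp [hi, hf, he])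
    (by simp [hj, hf, he]) (by simp [hk, hf]) (by simp [hl, hf]) hne
  obtain rfl : d = e := (mul_inv_eq_one₀ he).1 hde
  have hρi : ρ i = i := hρfix i (by grind) (by grind)
  have hρj : ρ j = j := hρfix j (by grind) (by grind)
  have hσk : σ k = k := hσfix k (by grind) (by grind)
  have hσl : σ l = l := hσfix l (by grind) (by grind)
  refine ⟨σ * ρ, by simpa [hρi, hρj] using hσ, d, he, fun m ↦ ?_⟩
  rw [Equiv.Perm.mul_apply]
  obtain rfl | rfl | rfl | rfl := eq_or_eq_of_nodup hijkl m
  · rwa [hρi]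
  · rwa [hρj]
  · obtain ⟨hρk, -⟩ | ⟨hρk, -⟩ := hρ <;> rw [hρk] at hk ⊢ <;> simpa [hσk, hσl] using hk
  · obtain ⟨-, hρl⟩ | ⟨-, hρl⟩ := hρ <;> rw [hρl] at hl ⊢ <;> simpa [hσk, hσl] using hl

end IsContactFrame

end Frame

section PolyOnLines

open Polynomial

variable (K V : Type*) [Field K] [AddCommGroup V] [Module K V]

/-- The functions on a vector space whose restriction to every affine line is polynomial. They
serve to choose vectors in general position: over an infinite field this algebra has no zero
divisors, so finitely many of its nonzero members are nonzero at a common point. -/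
def polyOnLines : Subalgebra K (V → K) where
  carrier := {f | ∀ x v, ∃ p : K[X], ∀ t, f (x + t • v) = p.eval t}
  mul_mem' := fun hf hg x v ↦ by
    obtain ⟨p, hp⟩ := hf x v
    obtain ⟨q, hq⟩ := hg x v
    exact ⟨p * q, by simp [hp, hq]⟩
  add_mem' := fun hf hg x v ↦ by
    obtain ⟨p, hp⟩ := hf x v
    obtain ⟨q, hq⟩ := hg x v
    exact ⟨p + q, by simp [hp, hq]⟩
  algebraMap_mem' := fun r _ _ ↦ ⟨C r, by simp⟩

variable {K V}

namespace polyOnLines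

theorem linear_mem (φ : V →ₗ[K] K) : (φ : V → K) ∈ polyOnLines K V :=
  fun x v ↦ ⟨C (φ x) + X * C (φ v), fun t ↦ by simp; ring⟩

theorem quadratic_mem (C : LinearMap.BilinForm K V) : (fun x ↦ C x x) ∈ polyOnLines K V :=
  fun x v ↦ ⟨.C (C x x) + X * .C (C x v + C v x) + X ^ 2 * .C (C v v), fun t ↦ by simp; ring⟩

theorem exists_ne_zero_ne_zero [Infinite K] {f g : V → K} (hf : f ∈ polyOnLines K V)
    (hg : g ∈ polyOnLines K V) (hf0 : ∃ x, f x ≠ 0) (hg0 : ∃ x, g x ≠ 0) :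
    ∃ x, f x ≠ 0 ∧ g x ≠ 0 := by
  obtain ⟨x, hx⟩ := hf0
  obtain ⟨y, hy⟩ := hg0
  obtain ⟨p, hp⟩ := hf x (y - x)
  obtain ⟨q, hq⟩ := hg x (y - x)
  have hp0 : p ≠ 0 := by
    rintro rfl
    exact hx (by simpa using hp 0)
  have hq0 : q ≠ 0 := by
    rintro rfl
    exact hy (by simpa using hq 1)
  obtain ⟨t, ht⟩ := exists_eval_ne_zero_of_natDegree_lt_card (p * q) (mul_ne_zero hp0 hq0)
    (Cardinal.natCast_lt_aleph0.trans_le (Cardinal.aleph0_le_mk K))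
  rw [eval_mul, ← hp, ← hq] at ht
  exact ⟨_, ne_zero_and_ne_zero_of_mul ht⟩

theorem exists_ne_zero_forall_ne_zero [Infinite K] {ι : Type*} {S : Set ι} (hS : S.Finite)
    {f : ι → V → K} (hf : ∀ i, f i ∈ polyOnLines K V) (hf0 : ∀ i ∈ S, ∃ x, f i x ≠ 0)
    {g : V → K} (hg : g ∈ polyOnLines K V) (hg0 : ∃ x, g x ≠ 0) :
    ∃ x, g x ≠ 0 ∧ ∀ i ∈ S, f i x ≠ 0 := by
  induction S, hS using Set.Finite.induction_on generalizing g with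
  | empty => simpa using hg0
  | @insert i S _ _ ih =>
    obtain ⟨x, hgx, hfx⟩ :=
      exists_ne_zero_ne_zero hg (hf i) hg0 (hf0 i (Set.mem_insert i S))
    obtain ⟨y, hy, hyS⟩ := ih (fun j hj ↦ hf0 j (Set.mem_insert_of_mem i hj))
      (mul_mem hg (hf i)) ⟨x, mul_ne_zero hgx hfx⟩
    obtain ⟨hgy, hfy⟩ := ne_zero_and_ne_zero_of_mul hy
    exact ⟨y, hgy, Set.forall_insert_of_forall hyS hfy⟩

end polyOnLines

end PolyOnLines

section Secant

variable {K V : Type*} [Field K] [AddCommGroup V] [Module K V]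
  {A B C : LinearMap.BilinForm K V} {u : V}

/-- The Gram determinant of two vectors: the discriminant of the form on the line they span. -/
def gramDet (C : LinearMap.BilinForm K V) (x y : V) : K := C x x * C y y - C x y ^ 2

theorem gramDet_mem_polyOnLines (C : LinearMap.BilinForm K V) (u : V) :
    gramDet C u ∈ polyOnLines K V :=
  sub_mem (Subalgebra.smul_mem _ (polyOnLines.quadratic_mem C) (C u u))
    (pow_mem (polyOnLines.linear_mem (C u)) 2)

theorem gramDet_smul_add_smul (hC : C.IsSymm) (u y : V) (p q : K) :
    gramDet C u (p • y + q • u) = p ^ 2 * gramDet C u y := by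
  simp only [gramDet, map_add, map_smul, LinearMap.add_apply, LinearMap.smul_apply, smul_eq_mul,
    hC.eq y u]
  ring

theorem isotropic_of_sq_eq_neg_gramDet (hA : A.IsSymm) {p y : V} {ε : K}
    (hε : ε ^ 2 = -gramDet A p y) :
    A (A p p • y + (-A p y + ε) • p) (A p p • y + (-A p y + ε) • p) = 0 := by
  rw [gramDet] at hε
  simp only [map_add, map_smul, LinearMap.add_apply, LinearMap.smul_apply, smul_eq_mul,
    hA.eq y p]
  linear_combination A p p * hε

/-- Projecting from `u`: the second point of the quadric `A` on the line joining its point `u`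
to `y`. -/
def residualPoint (A : LinearMap.BilinForm K V) (u y : V) : V := (2 * A u y) • y + (-A y y) • u

theorem residualPoint_isotropic (hA : A.IsSymm) (hu : A u u = 0) (y : V) :
    A (residualPoint A u y) (residualPoint A u y) = 0 := by
  simp only [residualPoint, map_add, map_smul, LinearMap.add_apply, LinearMap.smul_apply,
    smul_eq_mul, hA.eq y u, hu]
  ring

theorem apply_residualPoint (hu : A u u = 0) (y : V) :
    A u (residualPoint A u y) = 2 * A u y ^ 2 := by
  simp only [residualPoint, map_add, map_smul, smul_eq_mul, hu]
  ring

theorem residualPoint_mem_polyOnLines (hB : B.IsSymm) (A : LinearMap.BilinForm K V) (u : V) :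
    (fun y ↦ B (residualPoint A u y) (residualPoint A u y)) ∈ polyOnLines K V := by
  have hexpand : (fun y ↦ B (residualPoint A u y) (residualPoint A u y)) =
      (4 : K) • ((A u) ^ 2 * fun y ↦ B y y) - (4 : K) • (A u * (fun y ↦ A y y) * B u) +
        B u u • (fun y ↦ A y y) ^ 2 := by
    ext y
    simp only [residualPoint, map_add, map_smul, LinearMap.add_apply, LinearMap.smul_apply,
      smul_eq_mul, hB.eq y u, Pi.add_apply, Pi.sub_apply, Pi.smul_apply, Pi.mul_apply,
      Pi.pow_apply]
    ring
  have hA1 := polyOnLines.linear_mem (A u)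
  have hA2 := polyOnLines.quadratic_mem A
  rw [hexpand]
  exact add_mem (sub_mem
    (Subalgebra.smul_mem _ (mul_mem (pow_mem hA1 2) (polyOnLines.quadratic_mem B)) _)
    (Subalgebra.smul_mem _ (mul_mem (mul_mem hA1 hA2) (polyOnLines.linear_mem (B u))) _))
    (Subalgebra.smul_mem _ (pow_mem hA2 2) _)

theorem exists_apply_eq_zero [FiniteDimensional K V] (h : ¬ C.Nondegenerate) :
    ∃ x, x ≠ 0 ∧ C x = 0 := by
  rw [LinearMap.BilinForm.nondegenerate_iff_ker_eq_bot, ← ne_eq, Submodule.ne_bot_iff] at h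
  obtain ⟨x, hx, hx0⟩ := h
  exact ⟨x, hx0, hx⟩

theorem finite_setOf_degenerate [FiniteDimensional K V] (hA : A.Nondegenerate)
    (B : LinearMap.BilinForm K V) : {s : K | ¬ (B + s • A).Nondegenerate}.Finite := by
  have hfin := Module.End.finite_hasEigenvalue (B.symmCompOfNondegenerate A hA)
  refine (hfin.preimage neg_injective.injOn).subset fun s hs ↦ ?_
  obtain ⟨x, hx, hsx⟩ := exists_apply_eq_zero hs
  refine Module.End.hasEigenvalue_of_hasEigenvector (x := x) ⟨?_, hx⟩
  refine Module.End.mem_eigenspace_iff.2 (LinearMap.ker_eq_bot.1 hA.ker_eq_bot ?_)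
  rw [LinearMap.BilinForm.comp_symmCompOfNondegenerate_apply, map_smul]
  exact (eq_neg_of_add_eq_zero_left hsx).trans (neg_smul s (A x)).symm

variable [NeZero (2 : K)]

theorem exists_self_ne_zero (hC : C.IsSymm) (hne : C ≠ 0) : ∃ x, C x x ≠ 0 := by
  contrapose! hne
  exact LinearMap.BilinForm.ext_of_isSymm hC ⟨fun _ _ ↦ rfl⟩ hne

theorem exists_gramDet_ne_zero (hC : C.IsSymm) (hrank : 2 ≤ finrank K (LinearMap.range C))
    (hu : C u u ≠ 0) : ∃ y, gramDet C u y ≠ 0 := by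
  by_contra! h
  have hpolar (x y : V) : C u u * C x y = C u x * C u y := by
    have hxy := h (x + y)
    have hx := h x
    have hy := h y
    simp only [gramDet, map_add, LinearMap.add_apply, hC.eq y x] at hxy hx hy
    exact mul_left_cancel₀ two_ne_zero (by linear_combination hxy - hx - hy)
  have hrange : LinearMap.range C ≤ span K {C u} := by
    rintro _ ⟨x, rfl⟩
    refine mem_span_singleton.2 ⟨(C u u)⁻¹ * C u x, LinearMap.ext fun y ↦ ?_⟩
    rw [LinearMap.smul_apply, smul_eq_mul, mul_assoc, ← hpolar, inv_mul_cancel_left₀ hu]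
  have := (finrank_mono hrange).trans (finrank_span_le_card _)
  rw [Set.toFinset_singleton, Finset.card_singleton] at this
  lia

theorem exists_isotropic [IsAlgClosed K] (hA : A.IsSymm) (hB : B.IsSymm)
    (hrank : 2 ≤ finrank K (LinearMap.range A)) (hBA : ∀ s : K, B + s • A ≠ 0) :
    ∃ u, A u u = 0 ∧ B u u ≠ 0 := by
  have hA0 : A ≠ 0 := by
    rintro rfl
    rw [LinearMap.range_zero, finrank_bot] at hrank
    lia
  obtain ⟨p, hp⟩ := exists_self_ne_zero hA hA0
  set C := B + -(B p p / A p p) • A with hCdef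
  have hC : C.IsSymm := hB.add (hA.smul _)
  have hCp : C p p = 0 := by simp [hCdef, hp]
  obtain ⟨y, hy, hgram⟩ := polyOnLines.exists_ne_zero_ne_zero (polyOnLines.quadratic_mem C)
    (gramDet_mem_polyOnLines A p) (exists_self_ne_zero hC (hBA _))
    (exists_gramDet_ne_zero hA hrank hp)
  obtain ⟨δ, hδ⟩ := IsAlgClosed.exists_pow_nat_eq (-gramDet A p y) two_pos
  have hδ0 : δ ≠ 0 := by
    rintro rfl
    exact hgram (by linear_combination hδ)
  by_contra! h
  have hCroot {ε : K} (hε : ε ^ 2 = -gramDet A p y) :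
      A p p * C y y + 2 * (-A p y + ε) * C p y = 0 := by
    have hu : C (A p p • y + (-A p y + ε) • p) (A p p • y + (-A p y + ε) • p) = 0 := by
      have hroot := isotropic_of_sq_eq_neg_gramDet hA hε
      simp only [hCdef, LinearMap.add_apply, LinearMap.smul_apply, h _ hroot, hroot, smul_zero,
        add_zero]
    simp only [map_add, map_smul, LinearMap.add_apply, LinearMap.smul_apply, smul_eq_mul,
      hC.eq y p, hCp] at hu
    exact mul_left_cancel₀ hp (by linear_combination hu)
  have hpos := hCroot hδ
  have hneg := hCroot (ε := -δ) (by rw [neg_sq, hδ])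
  have hCpy : C p y = 0 :=
    mul_left_cancel₀ (mul_ne_zero two_ne_zero (mul_ne_zero two_ne_zero hδ0))
      (by linear_combination hpos - hneg)
  exact hy (mul_left_cancel₀ hp (by linear_combination hpos - 2 * (-A p y + δ) * hCpy))

theorem exists_orthogonal_self_ne_zero [FiniteDimensional K V] (hA : A.IsSymm)
    (hAn : A.Nondegenerate) (hV : 3 ≤ finrank K V) (u : V) : ∃ p, A u p = 0 ∧ A p p ≠ 0 := by
  by_contra! h
  set W := LinearMap.ker (A u)
  have hrestrict : A.restrict W = 0 :=
    LinearMap.BilinForm.ext_of_isSymm (hA.restrict W) ⟨fun _ _ ↦ rfl⟩ fun x ↦ h x x.2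
  have hW : W ≤ A.orthogonal W := fun x hx y hy ↦
    LinearMap.congr_fun₂ hrestrict ⟨y, hy⟩ ⟨x, hx⟩
  have hle := finrank_mono hW
  have horth := LinearMap.BilinForm.finrank_orthogonal hAn W
  have hker : _ + finrank K W = _ := LinearMap.finrank_range_add_finrank_ker (A u)
  have hrange := (LinearMap.range (A u)).finrank_le
  rw [finrank_self] at hrange
  lia

theorem exists_secant [IsAlgClosed K] [FiniteDimensional K V] (hV : 3 ≤ finrank K V)
    (hA : A.IsSymm) (hAn : A.Nondegenerate) (hB : B.IsSymm)
    (hrank : ∀ s : K, 2 ≤ finrank K (LinearMap.range (B + s • A))) :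
    ∃ u v, A u u = 0 ∧ A v v = 0 ∧ A u v = 1 ∧ B u u ≠ 0 ∧ B v v ≠ 0 ∧
      ∀ s : K, ¬ (B + s • A).Nondegenerate → gramDet (B + s • A) u v ≠ 0 := by
  have hrankA : 2 ≤ finrank K (LinearMap.range A) := by
    rw [LinearMap.finrank_range_of_inj (LinearMap.ker_eq_bot.1 hAn.ker_eq_bot)]
    lia
  obtain ⟨u, hu, hBu⟩ := exists_isotropic hA hB hrankA fun s h ↦ by
    have := hrank s
    rw [h, LinearMap.range_zero, finrank_bot] at this
    lia
  have hsymm (s : K) : (B + s • A).IsSymm := hB.add (hA.smul s)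
  have hgram (s : K) : ∃ y, gramDet (B + s • A) u y ≠ 0 :=
    exists_gramDet_ne_zero (hsymm s) (hrank s) (by simpa [hu] using hBu)
  have hlinear : ∃ y, A u y ≠ 0 := by
    by_contra! h
    have hu0 := LinearMap.ker_eq_bot'.1 hAn.ker_eq_bot u (LinearMap.ext h)
    simp [hu0] at hBu
  have hresidual : ∃ y, B (residualPoint A u y) (residualPoint A u y) ≠ 0 := by
    obtain ⟨p, hp, hpp⟩ := exists_orthogonal_self_ne_zero hA hAn hV u
    exact ⟨p, by simp [residualPoint, hp, hpp, hBu]⟩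
  have hA1 := polyOnLines.linear_mem (A u)
  have hB2 := residualPoint_mem_polyOnLines hB A u
  obtain ⟨z, hz1, hz2⟩ := polyOnLines.exists_ne_zero_ne_zero hA1 hB2 hlinear hresidual
  obtain ⟨y, hy, hgramy⟩ := polyOnLines.exists_ne_zero_forall_ne_zero
    (finite_setOf_degenerate hAn B) (fun s ↦ gramDet_mem_polyOnLines (B + s • A) u)
    (fun s _ ↦ hgram s) (mul_mem hA1 hB2) ⟨z, mul_ne_zero hz1 hz2⟩
  obtain ⟨hAy, hBy⟩ := ne_zero_and_ne_zero_of_mul hy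
  have hscale : A u (residualPoint A u y) ≠ 0 := by
    rw [apply_residualPoint hu]
    exact mul_ne_zero two_ne_zero (pow_ne_zero 2 hAy)
  refine ⟨u, (A u (residualPoint A u y))⁻¹ • residualPoint A u y, hu, ?_, ?_, hBu, ?_, ?_⟩
  · simp [residualPoint_isotropic hA hu]
  · simp [hscale]
  · simp [hscale, hBy]
  · intro s hs
    rw [residualPoint, smul_add, smul_smul, smul_smul, gramDet_smul_add_smul (hsymm s),
      ← residualPoint]
    exact mul_ne_zero (pow_ne_zero 2 (mul_ne_zero (inv_ne_zero hscale)
      (mul_ne_zero two_ne_zero hAy))) (hgramy s hs)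

end Secant

section OrthogonalToSecant

variable {K V : Type*} [Field K] [AddCommGroup V] [Module K V]
  {A B : LinearMap.BilinForm K V} {u v : V}

theorem eq_zero_of_secant_of_orthogonal (hA : A.IsSymm) (hu : A u u = 0) (hv : A v v = 0)
    (huv : A u v = 1) {φ : V →ₗ[K] K} (hφu : φ u = 0) (hφv : φ v = 0)
    (hφ : ∀ w, A u w = 0 → A v w = 0 → φ w = 0) : φ = 0 := by
  ext y
  have hvu : A v u = 1 := (hA.eq v u).trans huv
  have := hφ (y - A v y • u - A u y • v) (by simp [hu, huv]) (by simp [hv, hvu])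
  simpa [hφu, hφv] using this

theorem exists_orthogonal_apply_sub_smul_ne_zero (hA : A.IsSymm) (hB : B.IsSymm)
    (hu : A u u = 0) (hv : A v v = 0) (huv : A u v = 1)
    (hgram : ∀ s : K, ¬ (B + s • A).Nondegenerate → gramDet (B + s • A) u v ≠ 0)
    {m : K} (hm : B u u * m ^ 2 = B v v) :
    ∃ w, A u w = 0 ∧ A v w = 0 ∧ B (v - m • u) w ≠ 0 := by
  by_contra! h
  set C := B + (m * B u u - B u v) • A with hC
  have hCsymm : C.IsSymm := hB.add (hA.smul _)
  have hkernel : C (v - m • u) = 0 := by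
    refine eq_zero_of_secant_of_orthogonal hA hu hv huv ?_ ?_ fun w hwu hwv ↦ ?_
    · simp [hC, hu, hA.eq v u, huv, hB.eq v u]
    · simp only [hC, map_sub, map_smul, LinearMap.add_apply, LinearMap.sub_apply,
        LinearMap.smul_apply, smul_eq_mul, hv, huv]
      linear_combination -hm
    · rw [hC, LinearMap.add_apply, LinearMap.add_apply, h w hwu hwv]
      simp [hwu, hwv]
  have hne : v - m • u ≠ 0 := by
    intro h0
    have : A u (v - m • u) = 1 := by simp [hu, huv]
    simp [h0] at this
  have hdeg : ¬ C.Nondegenerate := fun hnd ↦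
    hne (LinearMap.ker_eq_bot'.1 hnd.ker_eq_bot _ hkernel)
  have hshear := gramDet_smul_add_smul hCsymm u v 1 (-m)
  rw [one_smul, neg_smul, ← sub_eq_add_neg, one_pow, one_mul] at hshear
  refine hgram _ hdeg (hshear.symm.trans ?_)
  have hkernel' : C u (v - m • u) = 0 := by
    rw [← hCsymm.eq, hkernel, LinearMap.zero_apply]
  rw [gramDet, hkernel', hkernel, LinearMap.zero_apply]
  ring

theorem exists_orthogonal_to_secant_self_ne_zero [NeZero (2 : K)] [FiniteDimensional K V]
    (hV : 3 ≤ finrank K V) (hA : A.IsSymm) (hAn : A.Nondegenerate) (hu : A u u = 0)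
    (hv : A v v = 0) (huv : A u v = 1) : ∃ w, A u w = 0 ∧ A v w = 0 ∧ A w w ≠ 0 := by
  by_contra! h
  set W := LinearMap.ker ((A u).prod (A v))
  have hmem {w : V} (hwu : A u w = 0) (hwv : A v w = 0) : w ∈ W := by
    simp [W, hwu, hwv]
  have hrestrict : A.restrict W = 0 := by
    refine LinearMap.BilinForm.ext_of_isSymm (hA.restrict W) ⟨fun _ _ ↦ rfl⟩ fun w ↦ ?_
    obtain ⟨hwu, hwv⟩ := Prod.mk_eq_zero.1 w.2
    exact h w hwu hwv
  obtain ⟨w, hw, hw0⟩ := W.exists_mem_ne_zero_of_ne_bot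
    (LinearMap.ker_ne_bot_of_finrank_lt (by simp; lia))
  obtain ⟨hwu, hwv⟩ := Prod.mk_eq_zero.1 hw
  refine hw0 (LinearMap.ker_eq_bot'.1 hAn.ker_eq_bot w
    (eq_zero_of_secant_of_orthogonal hA hu hv huv ?_ ?_ fun y hyu hyv ↦ ?_))
  · exact (hA.eq w u).trans hwu
  · exact (hA.eq w v).trans hwv
  · exact LinearMap.congr_fun₂ hrestrict ⟨w, hw⟩ ⟨y, hmem hyu hyv⟩

theorem exists_orthogonal_to_secant [NeZero (2 : K)] [IsAlgClosed K] [FiniteDimensional K V]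
    (hV : 3 ≤ finrank K V) (hA : A.IsSymm) (hAn : A.Nondegenerate) (hB : B.IsSymm)
    (hu : A u u = 0) (hv : A v v = 0) (huv : A u v = 1) (hBu : B u u ≠ 0)
    (hgram : ∀ s : K, ¬ (B + s • A).Nondegenerate → gramDet (B + s • A) u v ≠ 0) :
    ∃ w, A u w = 0 ∧ A v w = 0 ∧ A w w = -2 ∧
      ∀ m : K, B u u * m ^ 2 = B v v → B v w ≠ m * B u w := by
  obtain ⟨m, hm⟩ := IsAlgClosed.exists_pow_nat_eq (B v v / B u u) two_pos
  set W := LinearMap.ker ((A u).prod (A v))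
  have hsubtype {P : V → Prop} (h : ∃ w, A u w = 0 ∧ A v w = 0 ∧ P w) : ∃ w : W, P w := by
    obtain ⟨w, hwu, hwv, hw⟩ := h
    exact ⟨⟨w, by simp [W, hwu, hwv]⟩, hw⟩
  have hroot (m' : K) (hm' : B u u * m' ^ 2 = B v v) : ∃ w : W, B (v - m' • u) w ≠ 0 :=
    hsubtype (exists_orthogonal_apply_sub_smul_ne_zero hA hB hu hv huv hgram hm')
  have hlin (m' : K) : (fun w : W ↦ B (v - m' • u) w) ∈ polyOnLines K W :=
    polyOnLines.linear_mem ((B (v - m' • u)).domRestrict W)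
  have hfinite : {m' | B u u * m' ^ 2 = B v v}.Finite :=
    (Set.toFinite {m, -m}).subset fun m' hm' ↦
      sq_eq_sq_iff_eq_or_eq_neg.1 ((eq_div_of_mul_eq hBu ((mul_comm _ _).trans hm')).trans hm.symm)
  obtain ⟨w, hww, hw⟩ := polyOnLines.exists_ne_zero_forall_ne_zero
    hfinite hlin hroot (polyOnLines.quadratic_mem (A.restrict W))
    (hsubtype (exists_orthogonal_to_secant_self_ne_zero hV hA hAn hu hv huv))
  obtain ⟨hwu, hwv⟩ := Prod.mk_eq_zero.1 w.2
  rw [LinearMap.BilinForm.restrict_apply, LinearMap.domRestrict_apply] at hww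
  obtain ⟨e, he⟩ := IsAlgClosed.exists_pow_nat_eq (-2 / A w w) two_pos
  have he0 : e ≠ 0 := by
    rintro rfl
    exact div_ne_zero (neg_ne_zero.2 two_ne_zero) hww (by rw [← he, zero_pow two_ne_zero])
  refine ⟨e • w, by simp [hwu], by simp [hwv], ?_, fun m' hm' h ↦ hw m' hm' ?_⟩
  · simp only [map_smul, LinearMap.smul_apply, smul_eq_mul]
    rw [← mul_assoc, ← sq, he, div_mul_cancel₀ _ hww]
  · simp only [map_smul, smul_eq_mul] at h
    simp only [map_sub, map_smul, LinearMap.sub_apply, LinearMap.smul_apply, smul_eq_mul]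
    exact mul_left_cancel₀ he0 (by linear_combination h)

end OrthogonalToSecant

section Quartic

open Polynomial

variable {K : Type*} [Field K]

theorem exists_injective_roots [IsAlgClosed K] {p : K[X]} {n : ℕ} (hn : p.natDegree = n)
    (hp : p ≠ 0) (hsimple : ∀ x, p.eval x = 0 → (derivative p).eval x ≠ 0) :
    ∃ x : Fin n → K, Function.Injective x ∧
      ∀ y, p.eval y = p.leadingCoeff * ∏ i, (y - x i) := by
  classical
  have hnodup : p.roots.Nodup := by
    refine Multiset.nodup_iff_count_le_one.2 fun x ↦ ?_
    rw [count_roots]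
    by_contra! hlt
    obtain ⟨hroot, hroot'⟩ := (one_lt_rootMultiplicity_iff_isRoot hp).1 hlt
    exact hsimple x hroot hroot'
  have hsplits := IsAlgClosed.splits p
  have hcard : p.roots.toFinset.card = n := by
    rw [Multiset.toFinset_card_of_nodup hnodup, ← hsplits.natDegree_eq_card_roots, hn]
  let e := (p.roots.toFinset.equivFinOfCardEq hcard).symm
  refine ⟨fun i ↦ e i, Subtype.val_injective.comp e.injective, fun y ↦ ?_⟩
  rw [hsplits.eval_eq_prod_roots, e.prod_comp fun z ↦ y - (z : K),
    Finset.prod_coe_sort p.roots.toFinset (fun z ↦ y - z), Finset.prod, Multiset.toFinset_val,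
    hnodup.dedup]

theorem finite_setOf_root_eq_mul_sq (p : K[X]) {r : K[X]} (hr : r ≠ 0) :
    {τ : K | ∃ x, x ≠ 0 ∧ r.eval x = 0 ∧ p.eval x = τ * x ^ 2}.Finite := by
  refine ((r.rootSet_finite K).image fun x ↦ p.eval x / x ^ 2).subset ?_
  rintro τ ⟨x, hx, hrx, hpx⟩
  refine ⟨x, mem_rootSet.2 ⟨hr, by simpa using hrx⟩, ?_⟩
  rw [div_eq_iff (pow_ne_zero 2 hx), hpx]

theorem eval_eq_of_natDegree_eq_four {p : K[X]} (hp : p.natDegree = 4) (x : K) :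
    p.eval x = p.coeff 4 * x ^ 4 + p.coeff 3 * x ^ 3 + p.coeff 2 * x ^ 2 + p.coeff 1 * x +
      p.coeff 0 := by
  rw [eval_eq_sum_range, hp]
  simp only [Finset.sum_range_succ, Finset.range_zero, Finset.sum_empty]
  ring

theorem finite_setOf_double_root [NeZero (2 : K)] {p : K[X]} (hp : p.natDegree = 4) :
    {τ : K | ∃ x, x ≠ 0 ∧ (p - C τ * X ^ 2).eval x = 0 ∧
      (derivative (p - C τ * X ^ 2)).eval x = 0}.Finite := by
  have hp4 : p.coeff 4 ≠ 0 := by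
    rw [← hp]
    exact leadingCoeff_ne_zero.2 (ne_zero_of_natDegree_gt hp.ge)
  have hr : X * derivative p - 2 * p ≠ 0 := by
    intro h
    have hcoeff := congrArg (coeff · 4) h
    simp only [coeff_sub, coeff_X_mul, coeff_derivative, coeff_ofNat_mul, coeff_zero] at hcoeff
    push_cast at hcoeff
    exact hp4 (mul_left_cancel₀ two_ne_zero (by linear_combination hcoeff))
  refine (finite_setOf_root_eq_mul_sq p hr).subset ?_
  rintro τ ⟨x, hx, hroot, hroot'⟩
  simp only [eval_sub, eval_mul, eval_C, eval_pow, eval_X, derivative_sub, derivative_mul,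
    derivative_C, derivative_X_pow] at hroot hroot'
  refine ⟨x, hx, ?_, sub_eq_zero.1 hroot⟩
  simp only [zero_mul, Nat.cast_ofNat, Nat.add_one_sub_one, pow_one, zero_add, eval_mul, eval_C,
    eval_X, eval_sub, eval_ofNat] at hroot' ⊢
  linear_combination x * hroot' - 2 * hroot

theorem finite_setOf_roots_mul_eq {p : K[X]} (hp : p.natDegree = 4) {m : K} (hm0 : m ≠ 0)
    (hm : p.coeff 4 * m ^ 2 = p.coeff 0 → p.coeff 1 ≠ m * p.coeff 3) :
    {τ : K | ∃ x y, x * y = m ∧ p.eval x = τ * x ^ 2 ∧ p.eval y = τ * y ^ 2}.Finite := by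
  set r : K[X] := C (p.coeff 4 * m ^ 2 - p.coeff 0) * (X ^ 4 - C (m ^ 2)) +
    C (m * (m * p.coeff 3 - p.coeff 1)) * (X ^ 3 - C m * X) with hr
  have hr0 : r ≠ 0 := by
    intro h
    have h4 := congrArg (coeff · 4) h
    have h3 := congrArg (coeff · 3) h
    simp only [hr, coeff_add, coeff_C_mul, coeff_sub, coeff_X_pow, coeff_C, coeff_X, coeff_zero,
      Nat.reduceEqDiff, ↓reduceIte, OfNat.ofNat_ne_zero, sub_self, mul_zero, OfNat.one_ne_ofNat,
      sub_zero, mul_one, zero_add, mul_eq_zero, Nat.succ_ne_self, add_zero] at h3 h4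
    exact hm (by linear_combination h4) (by linear_combination -h3.resolve_left hm0)
  refine (finite_setOf_root_eq_mul_sq p hr0).subset ?_
  rintro τ ⟨x, y, hxy, hx, hy⟩
  subst hxy
  obtain ⟨hx0, hy0⟩ := ne_zero_and_ne_zero_of_mul hm0
  refine ⟨x, hx0, ?_, hx⟩
  rw [eval_eq_of_natDegree_eq_four hp] at hx hy
  simp only [hr, map_sub, map_mul, map_pow, eval_add, eval_mul, eval_sub, eval_C, eval_pow, eval_X]
  linear_combination x ^ 2 * (y ^ 2 * hx - x ^ 2 * hy)

theorem exists_quartic_roots [NeZero (2 : K)] [IsAlgClosed K] {p : K[X]} (hp : p.natDegree = 4)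
    (hp0 : p.coeff 0 ≠ 0) {S : Set K} (hS : S.Finite) (hS0 : ∀ m ∈ S, m ≠ 0)
    (hSm : ∀ m ∈ S, p.coeff 4 * m ^ 2 = p.coeff 0 → p.coeff 1 ≠ m * p.coeff 3) :
    ∃ τ : K, τ ≠ 0 ∧ ∃ x : Fin 4 → K, Function.Injective x ∧
      (∀ y, p.eval y - τ * y ^ 2 = p.coeff 4 * ∏ i, (y - x i)) ∧
      ∀ i j, x i * x j ∉ S := by
  obtain ⟨τ, hτ⟩ := (((finite_setOf_double_root hp).union
    (hS.biUnion fun m hm ↦ finite_setOf_roots_mul_eq hp (hS0 m hm) (hSm m hm))).union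
    (Set.finite_singleton 0)).exists_notMem
  simp only [Set.mem_union, Set.mem_iUnion, Set.mem_singleton_iff, not_or] at hτ
  obtain ⟨⟨hdouble, hmul⟩, hτ0⟩ := hτ
  have hdeg : (p - C τ * X ^ 2).natDegree = 4 := by
    rw [natDegree_sub_eq_left_of_natDegree_lt, hp]
    exact (natDegree_C_mul_X_pow_le τ 2).trans_lt (by simp [hp])
  have hlead : (p - C τ * X ^ 2).leadingCoeff = p.coeff 4 := by
    rw [leadingCoeff, hdeg, coeff_sub, coeff_C_mul_X_pow, if_neg (by decide), sub_zero]
  have heval (y : K) : (p - C τ * X ^ 2).eval y = p.eval y - τ * y ^ 2 := by simp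
  have hne {y : K} (hy : (p - C τ * X ^ 2).eval y = 0) : y ≠ 0 := by
    rintro rfl
    exact hp0 (by simpa [coeff_zero_eq_eval_zero] using hy)
  obtain ⟨x, hinj, hx⟩ := exists_injective_roots hdeg (ne_zero_of_natDegree_gt hdeg.ge)
    fun y hy hy' ↦ hdouble ⟨y, hne hy, hy, hy'⟩
  simp only [heval, hlead] at hx
  have hroot (i : Fin 4) : p.eval (x i) = τ * x i ^ 2 := by
    rw [← sub_eq_zero, hx, Finset.prod_eq_zero (Finset.mem_univ i) (sub_self _), mul_zero]
  exact ⟨τ, hτ0, x, hinj, hx, fun i j hm ↦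
    hmul ⟨_, hm, x i, x j, rfl, hroot i, hroot j⟩⟩

end Quartic

section Conic

open Polynomial

variable {K V : Type*} [Field K] [AddCommGroup V] [Module K V]
  {A B : LinearMap.BilinForm K V} {u v w : V}

/-- A frame of a plane that cuts the quadric `A` in a smooth conic, with two points `u` and `v` of
the conic and the pole `w` of the line joining them. The normalisation makes `conicPoint` a
parametrisation of the conic. -/
structure IsConicFrame (A : LinearMap.BilinForm K V) (u v w : V) : Prop where
  left_self : A u u = 0
  right_self : A v v = 0
  left_right : A u v = 1
  left_pole : A u w = 0
  right_pole : A v w = 0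
  pole_self : A w w = -2

/-- The point with parameter `x ≠ 0` of the conic of a conic frame. -/
def conicPoint (u v w : V) (x : K) : V := w + x • u + x⁻¹ • v

theorem apply_conicPoint (hB : B.IsSymm) (x y : K) :
    B (conicPoint u v w x) (conicPoint u v w y) =
      B w w + B u w * (x + y) + B v w * (x⁻¹ + y⁻¹) + B u u * (x * y) + B v v * (x⁻¹ * y⁻¹) +
        B u v * (x * y⁻¹ + y * x⁻¹) := by
  simp only [conicPoint, map_add, map_smul, LinearMap.add_apply, LinearMap.smul_apply, smul_eq_mul,
    hB.eq v u, hB.eq w u, hB.eq w v]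
  ring

theorem not_linearIndependent_conicPoint (x : Fin 4 → K) :
    ¬ LinearIndependent K fun i ↦ conicPoint u v w (x i) := by
  intro h
  have hcomp : (fun i ↦ conicPoint u v w (x i)) =
      Fintype.linearCombination K ![w, u, v] ∘ fun i ↦ ![1, x i, (x i)⁻¹] := by
    ext i
    simp [conicPoint, Fintype.linearCombination_apply, Fin.sum_univ_three]
  rw [hcomp] at h
  have := h.of_comp.fintype_card_le_finrank
  simp at this

/-- For points of the conic whose parameters have product `m`, the coefficient `s` for which
`B + s • A` is the mean of its diagonal values. -/
def conicShift (B : LinearMap.BilinForm K V) (u v : V) (m : K) : K :=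
  (B u u * m + B v v / m) / 2 - B u v

theorem conicShift_eq_of_mul_mul_eq {m n : K} (hm : m ≠ 0) (hn : n ≠ 0)
    (h : B u u * (m * n) = B v v) : conicShift B u v m = conicShift B u v n := by
  simp only [conicShift, ← h]
  field_simp
  ring

theorem finite_preimage_conicShift [NeZero (2 : K)] (hBu : B u u ≠ 0) {S : Set K}
    (hS : S.Finite) : (conicShift B u v ⁻¹' S).Finite := by
  refine hS.preimage' fun s _ ↦ ?_
  set r : K[X] := C (B u u) * X ^ 2 - C (2 * (s + B u v)) * X + C (B v v) with hr
  have hr0 : r ≠ 0 := by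
    intro h
    have := congrArg (coeff · 2) h
    simp only [hr, coeff_add, coeff_C_mul, coeff_sub, coeff_X_pow, coeff_C, coeff_X,
      coeff_zero] at this
    norm_num [hBu] at this
  refine ((r.rootSet_finite K).insert 0).subset fun m hm ↦ ?_
  refine or_iff_not_imp_left.2 fun hm0 ↦ mem_rootSet.2 ⟨hr0, ?_⟩
  have hms : (B u u * m + B v v / m) / 2 - B u v = s := hm
  field_simp at hms
  simp only [hr, map_add, map_sub, map_mul, map_pow, aeval_C, aeval_X, Algebra.algebraMap_self,
    RingHom.id_apply]
  linear_combination hms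

/-- The quartic whose value at `x` is `x ^ 2` times the value of `B` at the point of the conic with
parameter `x`. -/
noncomputable def conicQuartic (B : LinearMap.BilinForm K V) (u v w : V) : K[X] :=
  C (B u u) * X ^ 4 + C (2 * B u w) * X ^ 3 + C (B w w + 2 * B u v) * X ^ 2 +
    C (2 * B v w) * X + C (B v v)

theorem eval_conicQuartic (hB : B.IsSymm) {x : K} (hx : x ≠ 0) :
    (conicQuartic B u v w).eval x = B (conicPoint u v w x) (conicPoint u v w x) * x ^ 2 := by
  rw [apply_conicPoint hB]
  simp only [conicQuartic, eval_add, eval_mul, eval_pow, eval_C, eval_X]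
  field_simp
  ring

theorem natDegree_conicQuartic (hBu : B u u ≠ 0) : (conicQuartic B u v w).natDegree = 4 := by
  rw [conicQuartic]
  compute_degree!

theorem coeff_conicQuartic (B : LinearMap.BilinForm K V) (u v w : V) :
    (conicQuartic B u v w).coeff 4 = B u u ∧ (conicQuartic B u v w).coeff 3 = 2 * B u w ∧
      (conicQuartic B u v w).coeff 1 = 2 * B v w ∧ (conicQuartic B u v w).coeff 0 = B v v := by
  refine ⟨?_, ?_, ?_, ?_⟩ <;>
    simp only [conicQuartic, coeff_add, coeff_C_mul, coeff_X_pow, coeff_X, coeff_C] <;> norm_num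

namespace IsConicFrame

theorem apply_conicPoint (h : IsConicFrame A u v w) (hA : A.IsSymm) {x y : K} (hx : x ≠ 0)
    (hy : y ≠ 0) :
    A (conicPoint u v w x) (conicPoint u v w y) = (x - y) ^ 2 / (x * y) := by
  rw [_root_.apply_conicPoint hA, h.left_self, h.right_self, h.left_right, h.left_pole,
    h.right_pole, h.pole_self]
  field_simp
  ring

theorem apply_conicPoint_add_conicShift [NeZero (2 : K)] (h : IsConicFrame A u v w)
    (hA : A.IsSymm) (hB : B.IsSymm) {x y : K} (hx : x ≠ 0) (hy : y ≠ 0) :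
    B (conicPoint u v w x) (conicPoint u v w y) +
        conicShift B u v (x * y) * A (conicPoint u v w x) (conicPoint u v w y) =
      (B (conicPoint u v w x) (conicPoint u v w x) +
        B (conicPoint u v w y) (conicPoint u v w y)) / 2 := by
  rw [h.apply_conicPoint hA hx hy]
  simp only [_root_.apply_conicPoint hB, conicShift]
  field_simp
  ring

end IsConicFrame

theorem linearIndependent_triple_of_isotropic [NeZero (2 : K)] (hA : A.IsSymm) (hu : A u u = 0)
    (hv : A v v = 0) (hw : A w w = 0) (huv : A u v ≠ 0) (huw : A u w ≠ 0) (hvw : A v w ≠ 0) :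
    LinearIndependent K ![u, v, w] := by
  refine linearIndependent_triple_iff.2 fun p q r h ↦ ?_
  have h1 := congrArg (A u) h
  have h2 := congrArg (A v) h
  have h3 := congrArg (A w) h
  simp only [map_add, map_smul, smul_eq_mul, map_zero, hu, hv, hw, hA.eq v u, hA.eq w u,
    hA.eq w v] at h1 h2 h3
  refine ⟨?_, ?_, ?_⟩
  · exact mul_left_cancel₀ (mul_ne_zero two_ne_zero (mul_ne_zero huv huw))
      (by linear_combination A u w * h2 + A u v * h3 - A v w * h1)
  · exact mul_left_cancel₀ (mul_ne_zero two_ne_zero (mul_ne_zero huv hvw))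
      (by linear_combination A v w * h1 + A u v * h3 - A u w * h2)
  · exact mul_left_cancel₀ (mul_ne_zero two_ne_zero (mul_ne_zero huw hvw))
      (by linear_combination A v w * h1 + A u w * h2 - A u v * h3)

namespace IsConicFrame

theorem isContactFrame [NeZero (2 : K)] (h : IsConicFrame A u v w) (hA : A.IsSymm) (hB : B.IsSymm)
    {x : Fin 4 → K} {τ : K} (hτ : τ ≠ 0) (hinj : Function.Injective x) (hx : ∀ i, x i ≠ 0)
    (hnorm : ∀ i, B (conicPoint u v w (x i)) (conicPoint u v w (x i)) = τ)
    (hprod : B u u * ∏ i, x i = B v v)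
    (hnondeg : ∀ i j, (B + conicShift B u v (x i * x j) • A).Nondegenerate) :
    IsContactFrame A B (fun i ↦ conicPoint u v w (x i)) (fun k ↦ conicShift B u v (x 0 * x k))
      τ := by
  have hisotropic (i : Fin 4) : A (conicPoint u v w (x i)) (conicPoint u v w (x i)) = 0 := by
    rw [h.apply_conicPoint hA (hx i) (hx i), sub_self, zero_pow two_ne_zero, zero_div]
  have hpolar {i j : Fin 4} (hij : i ≠ j) :
      A (conicPoint u v w (x i)) (conicPoint u v w (x j)) ≠ 0 := by
    rw [h.apply_conicPoint hA (hx i) (hx j)]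
    exact div_ne_zero (pow_ne_zero 2 (sub_ne_zero.2 (hinj.ne hij))) (mul_ne_zero (hx i) (hx j))
  refine ⟨hisotropic, hnorm, hτ, fun i j hij ↦ ?_, fun k _ ↦ hnondeg 0 k, fun i j k hijk ↦ ?_, ?_,
    not_linearIndependent_conicPoint x⟩
  · have hshift : conicShift B u v (x 0 * x (pairIndex i j)) = conicShift B u v (x i * x j) := by
      obtain heq | heq := mul_pairIndex_eq_or x hij
      · rw [heq]
      · rw [← heq, mul_comm (x i * x j)] at hprod
        exact conicShift_eq_of_mul_mul_eq (mul_ne_zero (hx _) (hx _)) (mul_ne_zero (hx _) (hx _))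
          hprod
    rw [hshift, h.apply_conicPoint_add_conicShift hA hB (hx i) (hx j), hnorm, hnorm,
      add_self_div_two]
  · exact linearIndependent_triple_of_isotropic hA (hisotropic i) (hisotropic j) (hisotropic k)
      (hpolar (by grind)) (hpolar (by grind)) (hpolar (by grind))
  · refine ⟨(-2 : K)⁻¹ • A w, fun i ↦ ?_⟩
    have hwu : A w u = 0 := (hA.eq w u).trans h.left_pole
    have hwv : A w v = 0 := (hA.eq w v).trans h.right_pole
    simp [conicPoint, h.pole_self, hwu, hwv, inv_mul_cancel₀ (two_ne_zero (α := K))]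

theorem exists_isContactFrame [NeZero (2 : K)] [IsAlgClosed K] [FiniteDimensional K V]
    (h : IsConicFrame A u v w) (hA : A.IsSymm) (hAn : A.Nondegenerate) (hB : B.IsSymm)
    (hBu : B u u ≠ 0) (hBv : B v v ≠ 0)
    (hpole : ∀ m : K, B u u * m ^ 2 = B v v → B v w ≠ m * B u w) :
    ∃ (a : Fin 4 → V) (s : Fin 4 → K) (τ : K), IsContactFrame A B a s τ := by
  obtain ⟨hcoeff4, hcoeff3, hcoeff1, hcoeff0⟩ := coeff_conicQuartic B u v w
  set S := {m | m ≠ 0 ∧ ¬ (B + conicShift B u v m • A).Nondegenerate}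
  have hS : S.Finite := (finite_preimage_conicShift hBu (finite_setOf_degenerate hAn B)).subset
    fun m hm ↦ hm.2
  obtain ⟨τ, hτ, x, hinj, hfactor, hxS⟩ := exists_quartic_roots (natDegree_conicQuartic hBu)
    (hcoeff0 ▸ hBv) hS (fun m hm ↦ hm.1) fun m _ hm h ↦ by
      rw [hcoeff4, hcoeff0] at hm
      rw [hcoeff1, hcoeff3] at h
      exact hpole m hm (mul_left_cancel₀ two_ne_zero (by linear_combination h))
  rw [hcoeff4] at hfactor
  have hprod : B u u * ∏ i, x i = B v v := by
    have := hfactor 0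
    rw [← coeff_zero_eq_eval_zero, hcoeff0] at this
    simpa [Fin.prod_univ_four] using this.symm
  have hx (i : Fin 4) : x i ≠ 0 := fun hi ↦
    hBv (by rw [← hprod, Finset.prod_eq_zero (Finset.mem_univ i) hi, mul_zero])
  have hnorm (i : Fin 4) : B (conicPoint u v w (x i)) (conicPoint u v w (x i)) = τ := by
    have := hfactor (x i)
    rw [eval_conicQuartic hB (hx i), Finset.prod_eq_zero (Finset.mem_univ i) (sub_self _),
      mul_zero, sub_eq_zero] at this
    exact mul_right_cancel₀ (pow_ne_zero 2 (hx i)) this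
  exact ⟨_, _, τ, h.isContactFrame hA hB hτ hinj hx hnorm hprod fun i j ↦
    not_not.1 fun hdeg ↦ hxS i j ⟨mul_ne_zero (hx i) (hx j), hdeg⟩⟩

end IsConicFrame

theorem exists_isContactFrame [NeZero (2 : K)] [IsAlgClosed K] [FiniteDimensional K V]
    (hV : 3 ≤ finrank K V) (hA : A.IsSymm) (hAn : A.Nondegenerate) (hB : B.IsSymm)
    (hrank : ∀ s : K, 2 ≤ finrank K (LinearMap.range (B + s • A))) :
    ∃ (a : Fin 4 → V) (s : Fin 4 → K) (τ : K), IsContactFrame A B a s τ := by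
  obtain ⟨u, v, hu, hv, huv, hBu, hBv, hgram⟩ := exists_secant hV hA hAn hB hrank
  obtain ⟨w, hwu, hwv, hww, hpole⟩ :=
    exists_orthogonal_to_secant hV hA hAn hB hu hv huv hBu hgram
  exact IsConicFrame.exists_isContactFrame ⟨hu, hv, huv, hwu, hwv, hww⟩ hA hAn hB hBu hBv hpole

end Conic

theorem DualPencil.exists_basis {F : DualPencil} {Γ : Quadric} (h : F.Has Γ) :
    ∃ B, LinearIndependent ℂ ![Γ.mat⁻¹, B] ∧ F.forms = span ℂ {Γ.mat⁻¹, B} := by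
  have hΓ : (⟨Γ.mat⁻¹, h⟩ : F.forms) ≠ 0 := fun h0 ↦
    Γ.det_mat_inv_ne_zero (by rw [show Γ.mat⁻¹ = 0 from congrArg Subtype.val h0]; simp)
  obtain ⟨⟨B, hB⟩, hind⟩ :=
    exists_linearIndependent_pair_of_one_lt_finrank (by rw [F.dim]; exact one_lt_two) hΓ
  have hpair : LinearIndependent ℂ ![Γ.mat⁻¹, B] := LinearIndependent.pair_iff.2 fun p q hpq ↦
    LinearIndependent.pair_iff.1 hind p q (Subtype.ext hpq)
  refine ⟨B, hpair, (eq_of_le_of_finrank_eq (span_le.2 (Set.pair_subset h hB)) ?_).symm⟩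
  rw [← range_cons_cons_empty, finrank_span_eq_card hpair, Fintype.card_fin, F.dim]

theorem Quadric.dual_apply_eq_mul {Γ Γ₀ : Quadric} {B : Matrix (Fin 4) (Fin 4) ℂ} {x s : ℂ}
    (h : Γ.mat⁻¹ = x • (B + s • Γ₀.mat⁻¹)) (u v : Coord) :
    Γ.dual u v = x * (toBilin' B u v + s * Γ₀.dual u v) := by
  simp [dual, h, mul_add]

theorem Quadric.nondegenerate_of_mat_inv_eq {Γ : Quadric} {M : Matrix (Fin 4) (Fin 4) ℂ} {x : ℂ}
    (h : Γ.mat⁻¹ = x • M) : (toBilin' M).Nondegenerate := by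
  have hdet := Γ.det_mat_inv_ne_zero
  rw [h, det_smul] at hdet
  exact LinearMap.BilinForm.nondegenerate_toBilin'_iff_det_ne_zero.2 (right_ne_zero_of_mul hdet)

namespace Config

variable {F : DualPencil} {c c' : Config} {a a' : Fin 4 → Coord} {i j k : Fin 4}

theorem line_eq_ann (ha : ∀ i, c.plane i = planeOf (a i)) (i j : Fin 4) :
    c.line i j = ann (span ℂ {a i, a j}) := by
  rw [line, ha, ha, planeOf_inf_planeOf]

theorem span_eq_of_line_eq (ha : ∀ i, c.plane i = planeOf (a i))
    (ha' : ∀ i, c'.plane i = planeOf (a' i)) (h : c.line i j = c'.line i j) :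
    span ℂ {a' i, a' j} = span ℂ {a i, a j} :=
  ann_injective (by rw [← line_eq_ann ha, ← line_eq_ann ha', h])

namespace IsLebesgue

theorem exists_coords (hc : c.IsLebesgue F) :
    ∃ a : Fin 4 → Coord, ∀ i, c.plane i = planeOf (a i) := by
  choose a ha using fun i ↦ (Quadric.isTangentPlane_iff _).1 (hc.tangent i)
  exact ⟨a, fun i ↦ (ha i).2.2⟩

theorem linearIndependent_coords (hc : c.IsLebesgue F) (ha : ∀ i, c.plane i = planeOf (a i))
    (hijk : [i, j, k].Nodup) : LinearIndependent ℂ ![a i, a j, a k] := by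
  have notMem {i j k} (h : [j, k, i].Nodup) : a i ∉ span ℂ {a j, a k} := by
    rw [← ann_le_planeOf, ← line_eq_ann ha, ← ha]
    exact hc.no_three j k i (by grind) (by grind) (by grind)
  exact linearIndependent_triple_of_notMem_span (notMem (by grind)) (notMem (by grind))
    (notMem hijk)

theorem isContactPlane_iff (hc : c.IsLebesgue F) (ha : ∀ i, c.plane i = planeOf (a i))
    (hij : i ≠ j) {τ : Submodule ℂ Coord} :
    c.IsContactPlane i j τ ↔ ∃ t ∈ span ℂ {a i, a j}, t ≠ 0 ∧
      (∀ b ∈ span ℂ {a i, a j}, (c.quadric (pairIndex i j)).dual b t = 0) ∧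
      (∃ b ∈ span ℂ {a i, a j}, (c.quadric (pairIndex i j)).dual b b ≠ 0) ∧ τ = planeOf t := by
  obtain ⟨k, l, hijkl⟩ := exists_nodup_of_ne hij
  rw [IsContactPlane, line_eq_ann ha, Quadric.touches_ann_iff]
  exact finrank_span_pair_of_triple (hc.linearIndependent_coords ha (by grind : [i, j, k].Nodup))

theorem exists_contact_pencil (hc : c.IsLebesgue F) (ha : ∀ i, c.plane i = planeOf (a i)) :
    ∃ D : Submodule ℂ Coord, finrank ℂ D = 2 ∧ ∀ i j, i ≠ j → ∃ t ∈ D, t ≠ 0 ∧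
      t ∈ span ℂ {a i, a j} ∧
      ∀ b ∈ span ℂ {a i, a j}, (c.quadric (pairIndex i j)).dual b t = 0 := by
  obtain ⟨Δ, hΔ, hcontact⟩ := hc.contact
  refine ⟨ann Δ, by rw [finrank_ann, hΔ]; rfl, fun i j hij ↦ ?_⟩
  obtain ⟨τ, hτ, hle⟩ := hcontact i j hij
  obtain ⟨t, ht, ht0, hrad, -, rfl⟩ := (hc.isContactPlane_iff ha hij).1 hτ
  exact ⟨t, ann_le_planeOf.1 (by rwa [ann_ann]), ht0, ht, hrad⟩

theorem not_linearIndependent_coords (hc : c.IsLebesgue F)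
    (ha : ∀ i, c.plane i = planeOf (a i)) : ¬ LinearIndependent ℂ a := by
  intro hind
  obtain ⟨D, hD, hedge⟩ := hc.exists_contact_pencil ha
  refine not_meets_all_edges (basisOfLinearIndependentOfCardEqFinrank hind (by simp)) hD
    fun i j hij ↦ ?_
  obtain ⟨t, htD, ht0, ht, -⟩ := hedge i j hij
  exact ⟨t, htD, ht0, by simpa using ht⟩

theorem exists_common_point (hc : c.IsLebesgue F) :
    ∃ x : Coord, x ≠ 0 ∧ ∀ i j, i ≠ j → x ∈ c.line i j := by
  obtain ⟨a, ha⟩ := hc.exists_coords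
  have hdet : (of a).det = 0 := by
    by_contra hdet
    exact hc.not_linearIndependent_coords ha
      (linearIndependent_rows_iff_isUnit.2 ((isUnit_iff_isUnit_det _).2 (Ne.isUnit hdet)))
  obtain ⟨x, hx, hmul⟩ := exists_mulVec_eq_zero_iff.2 hdet
  have hplane (i : Fin 4) : x ∈ c.plane i := by
    rw [ha, mem_planeOf]
    exact congrFun hmul i
  exact ⟨x, hx, fun i j _ ↦ ⟨hplane i, hplane j⟩⟩

variable {Γ₀ : Quadric} {B : Matrix (Fin 4) (Fin 4) ℂ}

theorem coord_ne_zero (hc : c.IsLebesgue F) (ha : ∀ i, c.plane i = planeOf (a i)) (i : Fin 4) :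
    a i ≠ 0 := by
  obtain ⟨j, k, hijk⟩ : ∃ j k, [i, j, k].Nodup := by decide +revert
  exact (hc.linearIndependent_coords ha hijk).ne_zero 0

theorem dual_coord_self (hc : c.IsLebesgue F) (ha : ∀ i, c.plane i = planeOf (a i)) (i : Fin 4) :
    (c.quadric 0).dual (a i) (a i) = 0 :=
  (Quadric.isTangentPlane_planeOf _ (hc.coord_ne_zero ha i)).1 (ha i ▸ hc.tangent i)

theorem not_same (hc : c.IsLebesgue F) (hij : i ≠ j) :
    ¬ (c.quadric 0).Same (c.quadric (pairIndex i j)) := by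
  intro hsame
  obtain ⟨x, -, hx⟩ := Quadric.same_iff.1 hsame
  obtain ⟨a, ha⟩ := hc.exists_coords
  have hself (m : Fin 4) : (c.quadric (pairIndex i j)).dual (a m) (a m) = 0 := by
    have := hc.dual_coord_self ha m
    rw [Quadric.dual] at this
    rw [Quadric.dual, hx, map_smul, LinearMap.smul_apply, LinearMap.smul_apply, this, smul_zero]
  obtain ⟨Δ, -, hcontact⟩ := hc.contact
  obtain ⟨τ, hτ, -⟩ := hcontact i j hij
  obtain ⟨t, ht, ht0, hrad, ⟨b, hb, hbb⟩, -⟩ := (hc.isContactPlane_iff ha hij).1 hτ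
  obtain ⟨p, q, rfl⟩ := mem_span_pair.1 ht
  obtain ⟨p', q', rfl⟩ := mem_span_pair.1 hb
  have hi := hrad (a i) (subset_span (by simp))
  have hj := hrad (a j) (subset_span (by simp))
  have hsymm := (c.quadric (pairIndex i j)).isSymm_dual.eq (a j) (a i)
  simp only [map_add, map_smul, LinearMap.add_apply, LinearMap.smul_apply, smul_eq_mul, hself,
    hsymm] at hi hj hbb
  have hpolar : (c.quadric (pairIndex i j)).dual (a i) (a j) ≠ 0 := fun h ↦ hbb (by simp [h])
  have hq : q = 0 := by simpa [hpolar] using hi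
  have hp : p = 0 := by simpa [hpolar] using hj
  exact ht0 (by simp [hp, hq])

theorem dual_self_ne_zero (hc : c.IsLebesgue F) (hg : c.IsGeneral F)
    (ha : ∀ i, c.plane i = planeOf (a i)) (hij : i ≠ j) :
    (c.quadric (pairIndex i j)).dual (a i) (a i) ≠ 0 := fun h ↦
  hc.not_same hij (hg i _ (hc.mem _)
    (ha i ▸ (Quadric.isTangentPlane_planeOf _ (hc.coord_ne_zero ha i)).2 h))

theorem exists_contact_pencil_of_isGeneral (hc : c.IsLebesgue F) (hg : c.IsGeneral F)
    (ha : ∀ i, c.plane i = planeOf (a i)) :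
    ∃ D : Submodule ℂ Coord, finrank ℂ D = 2 ∧ ∀ i j, i ≠ j → ∃ p q : ℂ, p ≠ 0 ∧ q ≠ 0 ∧
      p • a i + q • a j ∈ D ∧
      ∀ b ∈ span ℂ {a i, a j}, (c.quadric (pairIndex i j)).dual b (p • a i + q • a j) = 0 := by
  obtain ⟨D, hD, hedge⟩ := hc.exists_contact_pencil ha
  refine ⟨D, hD, fun i j hij ↦ ?_⟩
  obtain ⟨t, htD, ht0, ht, hrad⟩ := hedge i j hij
  obtain ⟨p, q, rfl⟩ := mem_span_pair.1 ht
  refine ⟨p, q, ?_, ?_, htD, hrad⟩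
  · rintro rfl
    have hq : q = 0 := by
      simpa [pairIndex_comm i j, hc.dual_self_ne_zero hg ha hij.symm] using
        hrad (a j) (subset_span (by simp))
    exact ht0 (by simp [hq])
  · rintro rfl
    have hp : p = 0 := by
      simpa [hc.dual_self_ne_zero hg ha hij] using hrad (a i) (subset_span (by simp))
    exact ht0 (by simp [hp])

theorem exists_height (hc : c.IsLebesgue F) (hg : c.IsGeneral F)
    (ha : ∀ i, c.plane i = planeOf (a i)) :
    ∃ f : Dual ℂ Coord, (∀ i, f (a i) ≠ 0) ∧ ∀ i j, i ≠ j → ∀ b ∈ span ℂ {a i, a j},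
      (c.quadric (pairIndex i j)).dual b (f (a j) • a i - f (a i) • a j) = 0 := by
  obtain ⟨D, hD, hedge⟩ := hc.exists_contact_pencil_of_isGeneral hg ha
  choose! p q hp hq hpq hrad using hedge
  have ha0 : a 0 ∉ D := by
    intro h0
    have hmem (j : Fin 4) (hj : 0 ≠ j) : a j ∈ D := by
      have := hpq 0 j hj
      rwa [add_mem_cancel_left (D.smul_mem _ h0), D.smul_mem_iff (hq 0 j hj)] at this
    have hle : span ℂ (Set.range ![a 0, a 1, a 2]) ≤ D := span_le.2 (by
      rintro _ ⟨m, rfl⟩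
      fin_cases m
      exacts [h0, hmem 1 (by decide), hmem 2 (by decide)])
    have := finrank_mono hle
    rw [finrank_span_eq_card (hc.linearIndependent_coords ha (by decide)), hD] at this
    simp at this
  obtain ⟨f, hf0, hfD⟩ := exists_le_ker_of_notMem ha0
  have hfpq (i j : Fin 4) (hij : i ≠ j) : p i j * f (a i) + q i j * f (a j) = 0 := by
    simpa using hfD (hpq i j hij)
  refine ⟨f, fun i ↦ ?_, fun i j hij b hb ↦ ?_⟩
  · rcases eq_or_ne 0 i with rfl | hi
    · exact hf0
    · intro h
      simpa [h, hf0, hp 0 i hi] using hfpq 0 i hi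
  · have hsmul : p i j • (f (a j) • a i - f (a i) • a j) =
        f (a j) • (p i j • a i + q i j • a j) := by
      linear_combination (norm := module) -hfpq i j hij • a j
    refine (smul_eq_zero.1 ?_).resolve_left (hp i j hij)
    rw [← map_smul, hsmul, map_smul, hrad i j hij b hb, smul_zero]

theorem exists_normalized_coords (hc : c.IsLebesgue F) (hg : c.IsGeneral F) :
    ∃ a : Fin 4 → Coord, (∀ i, c.plane i = planeOf (a i)) ∧
      (∃ f : Dual ℂ Coord, ∀ i, f (a i) = 1) ∧
      ∀ i j, i ≠ j → ∀ b ∈ span ℂ {a i, a j},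
        (c.quadric (pairIndex i j)).dual b (a i - a j) = 0 := by
  obtain ⟨a, ha⟩ := hc.exists_coords
  obtain ⟨f, hf, hrad⟩ := hc.exists_height hg ha
  have hplane (i : Fin 4) : c.plane i = planeOf ((f (a i))⁻¹ • a i) := by
    rw [ha, planeOf_smul (inv_ne_zero (hf i))]
  refine ⟨fun i ↦ (f (a i))⁻¹ • a i, hplane, ⟨f, fun i ↦ by simp [hf i]⟩,
    fun i j hij b hb ↦ ?_⟩
  have hspan := ann_injective ((line_eq_ann hplane i j).symm.trans (line_eq_ann ha i j))
  have hsub : (f (a i))⁻¹ • a i - (f (a j))⁻¹ • a j =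
      (f (a i) * f (a j))⁻¹ • (f (a j) • a i - f (a i) • a j) := by
    have hi := hf i
    have hj := hf j
    match_scalars <;> field_simp
  rw [hsub, map_smul, hrad i j hij b (hspan ▸ hb), smul_zero]

theorem exists_shift (hc : c.IsLebesgue F) (hΓ : Γ₀.Same (c.quadric 0))
    (hF : F.forms = span ℂ {Γ₀.mat⁻¹, B}) :
    ∃ s : Fin 4 → ℂ, ∀ k, k ≠ 0 →
      ∃ x : ℂ, x ≠ 0 ∧ (c.quadric k).mat⁻¹ = x • (B + s k • Γ₀.mat⁻¹) := by
  suffices h : ∀ k, k ≠ 0 →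
      ∃ s x : ℂ, x ≠ 0 ∧ (c.quadric k).mat⁻¹ = x • (B + s • Γ₀.mat⁻¹) by
    choose! s hs using h
    exact ⟨s, hs⟩
  intro k hk
  have hmem : (c.quadric k).mat⁻¹ ∈ F.forms := hc.mem k
  obtain ⟨y, x, hxy⟩ := mem_span_pair.1 (hF ▸ hmem)
  have hx : x ≠ 0 := by
    rintro rfl
    obtain ⟨r, hr, hr0⟩ := Quadric.same_iff.1 hΓ
    have hy : y ≠ 0 := by
      rintro rfl
      exact (c.quadric k).det_mat_inv_ne_zero (by simp [← hxy])
    refine hc.not_same hk.symm ?_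
    rw [pairIndex_zero_left, Quadric.same_iff]
    exact ⟨y / r, div_ne_zero hy hr, by rw [hr0, smul_smul, div_mul_cancel₀ _ hr, ← hxy]; simp⟩
  exact ⟨y / x, x, hx, by rw [smul_add, smul_smul, mul_div_cancel₀ _ hx, add_comm, hxy]⟩

end IsLebesgue

/-- The contact frame `a`, `s`, `τ` describes the configuration `c` in the pencil spanned by the
tangential matrices `Γ₀.mat⁻¹` and `B`; the quadrics are determined up to proportionality. -/
structure HasFrame (c : Config) (Γ₀ : Quadric) (B : Matrix (Fin 4) (Fin 4) ℂ)
    (a : Fin 4 → Coord) (s : Fin 4 → ℂ) (τ : ℂ) : Prop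
    extends IsContactFrame Γ₀.dual (toBilin' B) a s τ where
  plane : ∀ i, c.plane i = planeOf (a i)
  same : Γ₀.Same (c.quadric 0)
  quadric : ∀ k, k ≠ 0 → ∃ x : ℂ, x ≠ 0 ∧ (c.quadric k).mat⁻¹ = x • (B + s k • Γ₀.mat⁻¹)

variable {Γ₀ : Quadric} {B : Matrix (Fin 4) (Fin 4) ℂ} {s s' : Fin 4 → ℂ} {τ τ' : ℂ} {l : Fin 4}

theorem IsLebesgue.exists_hasFrame (hc : c.IsLebesgue F) (hg : c.IsGeneral F)
    (hΓ : Γ₀.Same (c.quadric 0)) (hF : F.forms = span ℂ {Γ₀.mat⁻¹, B}) :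
    ∃ a s τ, c.HasFrame Γ₀ B a s τ := by
  obtain ⟨a, ha, hheight, hrad⟩ := hc.exists_normalized_coords hg
  obtain ⟨s, hs⟩ := hc.exists_shift hΓ hF
  have hA (i : Fin 4) : Γ₀.dual (a i) (a i) = 0 := by
    obtain ⟨r, hr, hr0⟩ := Quadric.same_iff.1 hΓ
    simpa [Quadric.dual, hr0, hr] using hc.dual_coord_self ha i
  have hE (i j : Fin 4) (hij : i ≠ j) (b : Coord) (hb : b ∈ span ℂ {a i, a j}) :
      toBilin' B b (a i) + s (pairIndex i j) * Γ₀.dual b (a i) =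
        toBilin' B b (a j) + s (pairIndex i j) * Γ₀.dual b (a j) := by
    obtain ⟨x, hx, hquadric⟩ := hs _ (pairIndex_ne_zero hij)
    have := hrad i j hij b hb
    rw [Quadric.dual_apply_eq_mul hquadric, mul_eq_zero_iff_left hx, map_sub, map_sub] at this
    linear_combination this
  have hBsymm : (toBilin' B).IsSymm :=
    isSymm_toBilin'_iff_isSymm.2 (F.symm B (hF ▸ subset_span (by simp)))
  have hcontact (i j : Fin 4) (hij : i ≠ j) :
      toBilin' B (a i) (a j) + s (pairIndex i j) * Γ₀.dual (a i) (a j) =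
        toBilin' B (a i) (a i) := by
    rw [← hE i j hij _ (subset_span (by simp)), hA, mul_zero, add_zero]
  have hnorm (i : Fin 4) : toBilin' B (a i) (a i) = toBilin' B (a 0) (a 0) := by
    rcases eq_or_ne i 0 with rfl | hi
    · rfl
    · rw [← hcontact i 0 hi, ← hcontact 0 i hi.symm, hBsymm.eq (a i), Γ₀.isSymm_dual.eq (a i),
        pairIndex_comm]
  refine ⟨a, s, toBilin' B (a 0) (a 0), ⟨hA, hnorm, fun h0 ↦ ?_, fun i j hij ↦ ?_, fun k hk ↦ ?_,
    fun i j k ↦ hc.linearIndependent_coords ha, hheight, hc.not_linearIndependent_coords ha⟩,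
    ha, hΓ, hs⟩
  · obtain ⟨x, -, hquadric⟩ := hs _ (pairIndex_ne_zero (zero_ne_one : (0 : Fin 4) ≠ 1))
    refine hc.dual_self_ne_zero hg ha (zero_ne_one : (0 : Fin 4) ≠ 1) ?_
    rw [Quadric.dual_apply_eq_mul hquadric, h0, hA, mul_zero, add_zero, mul_zero]
  · rw [hcontact i j hij, hnorm]
  · obtain ⟨x, -, hquadric⟩ := hs k hk
    have := Quadric.nondegenerate_of_mat_inv_eq hquadric
    rwa [map_add, map_smul] at this

namespace HasFrame

theorem contactPlane_eq (hc : c.IsLebesgue F) (h : c.HasFrame Γ₀ B a s τ) (hij : i ≠ j)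
    {μ : Submodule ℂ Coord} (hμ : c.IsContactPlane i j μ) : μ = planeOf (a i - a j) := by
  obtain ⟨t, ht, ht0, hrad, -, rfl⟩ := (hc.isContactPlane_iff h.plane hij).1 hμ
  obtain ⟨p, q, rfl⟩ := mem_span_pair.1 ht
  obtain ⟨x, hx, hquadric⟩ := h.quadric _ (pairIndex_ne_zero hij)
  have hi := hrad (a i) (subset_span (by simp))
  rw [Quadric.dual_apply_eq_mul hquadric, mul_eq_zero_iff_left hx] at hi
  simp only [map_add, map_smul, smul_eq_mul, h.isotropic, h.norm] at hi
  have hpq : p + q = 0 := mul_right_cancel₀ h.norm_ne_zero (by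
    linear_combination hi - q * h.contact i j hij)
  have hp : p ≠ 0 := by
    rintro rfl
    exact ht0 (by rw [zero_add] at hpq; simp [hpq])
  rw [eq_neg_of_add_eq_zero_right hpq, neg_smul, ← sub_eq_add_neg, ← smul_sub, planeOf_smul hp]

theorem exists_smul_sub_eq (hc : c.IsLebesgue F) (hc' : c'.IsLebesgue F)
    (h : c.HasFrame Γ₀ B a s τ) (h' : c'.HasFrame Γ₀ B a' s' τ') (hij : i ≠ j)
    {μ : Submodule ℂ Coord} (hμ : c.IsContactPlane i j μ) (hμ' : c'.IsContactPlane i j μ) :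
    ∃ r : ℂ, r ≠ 0 ∧ a' i - a' j = r • (a i - a j) :=
  exists_smul_eq_of_planeOf_eq (sub_ne_zero.2 (h'.injective.ne hij))
    ((h.contactPlane_eq hc hij hμ).symm.trans (h'.contactPlane_eq hc' hij hμ'))

theorem plane_eq (h : c.HasFrame Γ₀ B a s τ) (h' : c'.HasFrame Γ₀ B a' s' τ')
    {σ : Equiv.Perm (Fin 4)} {e : ℂ} (he : e ≠ 0) (hσ : ∀ m, a' m = e • a (σ m)) (m : Fin 4) :
    c'.plane m = c.plane (σ m) := by
  rw [h'.plane, h.plane, hσ, planeOf_smul he]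

theorem same_quadric (hB : B.IsSymm) (h : c.HasFrame Γ₀ B a s τ)
    (h' : c'.HasFrame Γ₀ B a' s' τ') {σ : Equiv.Perm (Fin 4)} {e : ℂ} (he : e ≠ 0)
    (hσ : ∀ m, a' m = e • a (σ m)) (i j : Fin 4) :
    (c.quadric (pairIndex (σ i) (σ j))).Same (c'.quadric (pairIndex i j)) := by
  obtain ⟨M, x, y, hx, hy, hM, hM'⟩ : ∃ (M : Matrix (Fin 4) (Fin 4) ℂ) (x y : ℂ), x ≠ 0 ∧ y ≠ 0 ∧
      (c.quadric (pairIndex (σ i) (σ j))).mat⁻¹ = x • M ∧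
      (c'.quadric (pairIndex i j)).mat⁻¹ = y • M := by
    rcases eq_or_ne i j with rfl | hij
    · obtain ⟨x, hx, hM⟩ := Quadric.same_iff.1 h.same
      obtain ⟨y, hy, hM'⟩ := Quadric.same_iff.1 h'.same
      exact ⟨_, x, y, hx, hy, by rwa [pairIndex_self], by rwa [pairIndex_self]⟩
    · obtain ⟨x, hx, hM⟩ := h.quadric _ (pairIndex_ne_zero (σ.injective.ne hij))
      obtain ⟨y, hy, hM'⟩ := h'.quadric _ (pairIndex_ne_zero hij)
      rw [(h.toIsContactFrame.smul he).shift_eq (finrank_fin_fun ℂ).le Γ₀.isSymm_dual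
        (isSymm_toBilin'_iff_isSymm.2 hB) h'.toIsContactFrame hij (hσ i) (hσ j)] at hM'
      exact ⟨_, x, y, hx, hy, hM, hM'⟩
  exact Quadric.same_iff.2 ⟨y / x, div_ne_zero hy hx, by
    rw [hM, hM', smul_smul, div_mul_cancel₀ _ hx]⟩

end HasFrame

namespace IsLebesgue

theorem plane_eq_of_adjacent_lines (hc : c.IsLebesgue F) (hc' : c'.IsLebesgue F)
    (hijk : [i, j, k].Nodup) (hij : c.line i j = c'.line i j) (hik : c.line i k = c'.line i k) :
    c'.plane i = c.plane i := by
  obtain ⟨a, ha⟩ := hc.exists_coords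
  obtain ⟨a', ha'⟩ := hc'.exists_coords
  obtain ⟨e, he⟩ := exists_smul_eq_of_mem_span_pairs (u' := a' i)
    (hc.linearIndependent_coords ha hijk)
    (span_eq_of_line_eq ha ha' hij ▸ subset_span (by simp))
    (span_eq_of_line_eq ha ha' hik ▸ subset_span (by simp))
  have he0 : e ≠ 0 := left_ne_zero_of_smul (he ▸ hc'.coord_ne_zero ha' i)
  rw [ha', ha, he, planeOf_smul he0]

theorem eq_of_adjacent (hc : c.IsLebesgue F) (hg : c.IsGeneral F) (hc' : c'.IsLebesgue F)
    (hg' : c'.IsGeneral F) (hijk : [i, j, k].Nodup) (hij : c.line i j = c'.line i j)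
    (hik : c.line i k = c'.line i k) {μ τ : Submodule ℂ Coord} (hμ : c.IsContactPlane i j μ)
    (hμ' : c'.IsContactPlane i j μ) (hτ : c.IsContactPlane i k τ)
    (hτ' : c'.IsContactPlane i k τ) :
    (∀ m, c'.plane m = c.plane m) ∧ ∀ m, (c.quadric m).Same (c'.quadric m) := by
  have hplane := hc.plane_eq_of_adjacent_lines hc' hijk hij hik
  have hsame : (c.quadric 0).Same (c'.quadric 0) :=
    hg i _ (hc'.mem 0) (hplane ▸ hc'.tangent i)
  obtain ⟨B, -, hF⟩ := DualPencil.exists_basis (hc.mem 0)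
  have hB := F.symm B (hF ▸ subset_span (by simp))
  obtain ⟨a, s, _, h⟩ := hc.exists_hasFrame hg ⟨1, one_ne_zero, (one_smul _ _).symm⟩ hF
  obtain ⟨a', s', _, h'⟩ := hc'.exists_hasFrame hg' hsame hF
  obtain ⟨e, he, hi⟩ : ∃ e : ℂ, e ≠ 0 ∧ a' i = e • a i := exists_smul_eq_of_planeOf_eq
    (h'.ne_zero i) (by rw [← h.plane, ← h'.plane, hplane])
  have hall := h.eq_smul_of_adjacent (finrank_fin_fun ℂ).le (Quadric.isSymm_dual _)
    (isSymm_toBilin'_iff_isSymm.2 hB) h'.toIsContactFrame hijk he hi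
    (h.exists_smul_sub_eq hc hc' h' (by grind) hμ hμ')
    (h.exists_smul_sub_eq hc hc' h' (by grind) hτ hτ')
  refine ⟨h.plane_eq h' (σ := 1) he hall, fun m ↦ ?_⟩
  simpa only [Equiv.Perm.one_apply, pairIndex_zero_left] using
    h.same_quadric hB h' (σ := 1) he hall 0 m

theorem exists_perm_of_opposite (hc : c.IsLebesgue F) (hg : c.IsGeneral F)
    (hc' : c'.IsLebesgue F) (hg' : c'.IsGeneral F) (hsame : (c.quadric 0).Same (c'.quadric 0))
    (hijkl : [i, j, k, l].Nodup) (hij : c.line i j = c'.line i j) (hkl : c.line k l = c'.line k l)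
    {μ ν : Submodule ℂ Coord} (hμν : μ ≠ ν) (hμ : c.IsContactPlane i j μ)
    (hμ' : c'.IsContactPlane i j μ) (hν : c.IsContactPlane k l ν)
    (hν' : c'.IsContactPlane k l ν) :
    ∃ σ : Equiv.Perm (Fin 4), ((σ i = i ∧ σ j = j) ∨ (σ i = j ∧ σ j = i)) ∧
      (∀ m, c'.plane m = c.plane (σ m)) ∧
      ∀ m n, (c.quadric (pairIndex (σ m) (σ n))).Same (c'.quadric (pairIndex m n)) := by
  obtain ⟨B, -, hF⟩ := DualPencil.exists_basis (hc.mem 0)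
  have hB := F.symm B (hF ▸ subset_span (by simp))
  obtain ⟨a, s, _, h⟩ := hc.exists_hasFrame hg ⟨1, one_ne_zero, (one_smul _ _).symm⟩ hF
  obtain ⟨a', s', _, h'⟩ := hc'.exists_hasFrame hg' hsame hF
  have hne_ij : i ≠ j := by grind
  have hne_kl : k ≠ l := by grind
  obtain ⟨_, -, hr⟩ := h.exists_smul_sub_eq hc hc' h' hne_ij hμ hμ'
  obtain ⟨_, -, ht⟩ := h.exists_smul_sub_eq hc hc' h' hne_kl hν hν'
  have hdistinct (p : ℂ) (hp : p ≠ 0) : a' k - a' l ≠ p • (a' i - a' j) := fun hpar ↦ hμν (by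
    rw [h'.contactPlane_eq hc' hne_ij hμ', h'.contactPlane_eq hc' hne_kl hν', hpar,
      planeOf_smul hp])
  obtain ⟨σ, hσ, e, he, hall⟩ := h.toIsContactFrame.exists_perm_of_opposite
    (finrank_fin_fun ℂ).le (Quadric.isSymm_dual _) (isSymm_toBilin'_iff_isSymm.2 hB)
    h'.toIsContactFrame hijkl (span_eq_of_line_eq h.plane h'.plane hij) hr
    (span_eq_of_line_eq h.plane h'.plane hkl) ht hdistinct
  exact ⟨σ, hσ, h.plane_eq h' he hall, h.same_quadric hB h' he hall⟩

end IsLebesgue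

theorem exists_hasFrame (hB : B.IsSymm) (h : IsContactFrame Γ₀.dual (toBilin' B) a s τ) :
    ∃ c : Config, c.quadric 0 = Γ₀ ∧ c.HasFrame Γ₀ B a s τ := by
  have hdet (k : Fin 4) (hk : k ≠ 0) : (B + s k • Γ₀.mat⁻¹).det ≠ 0 := by
    rw [← LinearMap.BilinForm.nondegenerate_toBilin'_iff_det_ne_zero, map_add, map_smul]
    exact h.nondegenerate k hk
  let Q (k : Fin 4) : Quadric := if hk : k = 0 then Γ₀ else
    .ofDual (B + s k • Γ₀.mat⁻¹) (hB.add (Γ₀.symm.inv.smul _)) (hdet k hk)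
  have hQ : Q 0 = Γ₀ := dif_pos rfl
  refine ⟨⟨fun i ↦ planeOf (a i), Q⟩, hQ, h, fun _ ↦ rfl, ?_, fun k hk ↦ ⟨1, one_ne_zero, ?_⟩⟩
  · exact ⟨1, one_ne_zero, by rw [one_smul]; exact congrArg Quadric.mat hQ⟩
  · simp only [Q, dif_neg hk, one_smul]
    exact Quadric.ofDual_mat_inv _ _ _

namespace HasFrame

theorem isContactPlane (h : c.HasFrame Γ₀ B a s τ) (hij : i ≠ j) :
    c.IsContactPlane i j (planeOf (a i - a j)) := by
  obtain ⟨k, l, hijkl⟩ := exists_nodup_of_ne hij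
  obtain ⟨x, hx, hquadric⟩ := h.quadric _ (pairIndex_ne_zero hij)
  have hindep := h.independent i j k (by grind)
  rw [IsContactPlane, line_eq_ann h.plane,
    Quadric.touches_ann_iff _ (finrank_span_pair_of_triple hindep)]
  refine ⟨_, sub_mem (subset_span (by simp)) (subset_span (by simp)),
    sub_ne_zero.2 (h.injective.ne hij), fun b hb ↦ ?_, ⟨a i, subset_span (by simp), ?_⟩, rfl⟩
  · obtain ⟨p, q, rfl⟩ := mem_span_pair.1 hb
    have hji := h.contact j i hij.symm
    rw [pairIndex_comm] at hji
    rw [Quadric.dual_apply_eq_mul hquadric, mul_eq_zero_iff_left hx]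
    simp only [map_add, map_sub, map_smul, LinearMap.add_apply, LinearMap.smul_apply, smul_eq_mul,
      h.isotropic, h.norm]
    linear_combination q * hji - p * h.contact i j hij
  · rw [Quadric.dual_apply_eq_mul hquadric, h.norm, h.isotropic, mul_zero, add_zero]
    exact mul_ne_zero hx h.norm_ne_zero

theorem isLebesgue (hF : F.forms = span ℂ {Γ₀.mat⁻¹, B}) (h : c.HasFrame Γ₀ B a s τ) :
    c.IsLebesgue F where
  mem k := by
    rw [DualPencil.Has, hF]
    have hA : Γ₀.mat⁻¹ ∈ span ℂ {Γ₀.mat⁻¹, B} := subset_span (by simp)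
    have hB : B ∈ span ℂ {Γ₀.mat⁻¹, B} := subset_span (by simp)
    rcases eq_or_ne k 0 with rfl | hk
    · obtain ⟨r, -, hr⟩ := Quadric.same_iff.1 h.same
      exact hr ▸ smul_mem _ r hA
    · obtain ⟨x, -, hx⟩ := h.quadric k hk
      exact hx ▸ smul_mem _ x (add_mem hB (smul_mem _ _ hA))
  tangent i := by
    obtain ⟨r, -, hr⟩ := Quadric.same_iff.1 h.same
    have hi := h.isotropic i
    rw [Quadric.dual] at hi
    rw [h.plane, Quadric.isTangentPlane_planeOf _ (h.ne_zero i), Quadric.dual, hr, map_smul,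
      LinearMap.smul_apply, LinearMap.smul_apply, hi, smul_zero]
  no_three i j k hij hik hjk hle := by
    rw [line_eq_ann h.plane, h.plane, ann_le_planeOf, mem_span_pair] at hle
    obtain ⟨p, q, hpq⟩ := hle
    have := linearIndependent_triple_iff.1 (h.independent i j k (by simp [*])) p q (-1)
      (by rw [hpq]; module)
    exact neg_ne_zero.2 one_ne_zero this.2.2
  contact := by
    refine ⟨ann (vectorSpan ℂ (Set.range a)), by rw [finrank_ann, h.finrank_vectorSpan]; rfl,
      fun i j hij ↦ ⟨_, h.isContactPlane hij, ann_le_planeOf.2 ?_⟩⟩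
    exact vsub_mem_vectorSpan ℂ (Set.mem_range_self i) (Set.mem_range_self j)

theorem isGeneral (hF : F.forms = span ℂ {Γ₀.mat⁻¹, B}) (h : c.HasFrame Γ₀ B a s τ) :
    c.IsGeneral F := by
  intro i Γ hΓ htangent
  rw [DualPencil.Has, hF] at hΓ
  obtain ⟨y, x, hxy⟩ := mem_span_pair.1 hΓ
  rw [h.plane, Quadric.isTangentPlane_planeOf _ (h.ne_zero i), Quadric.dual, ← hxy, map_add,
    map_smul, map_smul] at htangent
  have hi := h.isotropic i
  rw [Quadric.dual] at hi
  have hx : x = 0 := by simpa [hi, h.norm, h.norm_ne_zero] using htangent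
  rw [hx, zero_smul, add_zero] at hxy
  have hy : y ≠ 0 := by
    rintro rfl
    exact Γ.det_mat_inv_ne_zero (by simp [← hxy])
  obtain ⟨r, hr, hr0⟩ := Quadric.same_iff.1 h.same
  exact Quadric.same_iff.2 ⟨y / r, div_ne_zero hy hr, by
    rw [hr0, smul_smul, div_mul_cancel₀ _ hr, hxy]⟩

end HasFrame

theorem exists_isLebesgue_isGeneral (hrank : ∀ B ∈ F.forms, B ≠ 0 → 2 ≤ B.rank)
    (hΓ : F.Has Γ₀) :
    ∃ c : Config, c.quadric 0 = Γ₀ ∧ c.IsLebesgue F ∧ c.IsGeneral F := by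
  obtain ⟨B, hind, hF⟩ := DualPencil.exists_basis hΓ
  have hBF : B ∈ F.forms := hF ▸ subset_span (by simp)
  have hB := F.symm B hBF
  have hrange (s : ℂ) :
      2 ≤ finrank ℂ (LinearMap.range (toBilin' B + s • Γ₀.dual)) := by
    rw [Quadric.dual, ← map_smul, ← map_add, finrank_range_toBilin']
    refine hrank _ (add_mem hBF (smul_mem _ s hΓ)) fun h0 ↦ ?_
    exact one_ne_zero (LinearIndependent.pair_iff.1 hind s 1 (by rw [one_smul, add_comm, h0])).2
  obtain ⟨a, s, τ, h⟩ := exists_isContactFrame (by simp) Γ₀.isSymm_dual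
    (LinearMap.BilinForm.nondegenerate_toBilin'_iff_det_ne_zero.2 Γ₀.det_mat_inv_ne_zero)
    (isSymm_toBilin'_iff_isSymm.2 hB) hrange
  obtain ⟨c, hc0, hc⟩ := exists_hasFrame hB h
  exact ⟨c, hc0, hc.isLebesgue hF, hc.isGeneral hF⟩

end Config

end

theorem mainTheorem7 (F : DualPencil) :
    -- existence, for every quadric `Γ₀` of a dual pencil without double points
    ((∀ B ∈ F.forms, B ≠ 0 → 2 ≤ B.rank) →
      ∀ Γ₀ : Quadric, F.Has Γ₀ →
        ∃ c : Config, c.quadric 0 = Γ₀ ∧ c.IsLebesgue F ∧ c.IsGeneral F) ∧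
    -- the six lines of intersection belong to one bundle
    (∀ c : Config, c.IsLebesgue F →
      ∃ x : Coord, x ≠ 0 ∧ ∀ i j, i ≠ j → x ∈ c.line i j) ∧
    -- two adjacent lines and their tangent planes determine everything
    (∀ c c' : Config, c.IsLebesgue F → c.IsGeneral F → c'.IsLebesgue F → c'.IsGeneral F →
      ∀ i j k : Fin 4, i ≠ j → i ≠ k → j ≠ k →
        c.line i j = c'.line i j → c.line i k = c'.line i k →
        ∀ μ τ : Submodule ℂ Coord,
          c.IsContactPlane i j μ → c'.IsContactPlane i j μ →
          c.IsContactPlane i k τ → c'.IsContactPlane i k τ →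
          (∀ a, c'.plane a = c.plane a) ∧ ∀ a, (c.quadric a).Same (c'.quadric a)) ∧
    -- two opposite lines and their (distinct) tangent planes determine, for a given `Γ₀`,
    -- everything up to interchanging the two planes through either line
    (∀ c c' : Config, c.IsLebesgue F → c.IsGeneral F → c'.IsLebesgue F → c'.IsGeneral F →
      (c.quadric 0).Same (c'.quadric 0) →
      ∀ i j k l : Fin 4, i ≠ j → i ≠ k → i ≠ l → j ≠ k → j ≠ l → k ≠ l →
        c.line i j = c'.line i j → c.line k l = c'.line k l →
        ∀ μ ν : Submodule ℂ Coord, μ ≠ ν →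
          c.IsContactPlane i j μ → c'.IsContactPlane i j μ →
          c.IsContactPlane k l ν → c'.IsContactPlane k l ν →
          ∃ σ : Equiv.Perm (Fin 4),
            ((σ i = i ∧ σ j = j) ∨ (σ i = j ∧ σ j = i)) ∧
            (∀ a, c'.plane a = c.plane (σ a)) ∧
            ∀ a b, (c.quadric (pairIndex (σ a) (σ b))).Same (c'.quadric (pairIndex a b))) := by
  refine ⟨fun hrank _ hΓ ↦ Config.exists_isLebesgue_isGeneral hrank hΓ,
    fun c hc ↦ hc.exists_common_point, ?_, ?_⟩
  · intro c c' hc hg hc' hg' i j k hij hik hjk hlij hlik μ τ hμ hμ' hτ hτ'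
    exact hc.eq_of_adjacent hg hc' hg' (by simp [*]) hlij hlik hμ hμ' hτ hτ'
  · intro c c' hc hg hc' hg' hsame i j k l hij hik hil hjk hjl hkl hlij hlkl μ ν hμν hμ hμ' hν hν'
    exact hc.exists_perm_of_opposite hg hc' hg' hsame (by simp [*]) hlij hlkl hμν hμ hμ' hν hν'
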